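/- Let $l$ be a positive integer. **The crystal $B_l$.** Let $B_l$ be the set of all $b=(x_1,x_2,x_3,\bar x_3,\bar x_2,\bar x_1)\in\mathbb Z_{\ge0}^6$ with $x_3\equiv\bar x_3\pmod 2$ and $s(b):=x_1+x_2+\frac{x_3+\bar x_3}2+\bar x_2+\bar x_1\le l$. It carries operators $\tilde e_a,\tilde f_a:B_l\to B_l\sqcup\{0\}$, $a=0,1,2$. Put $(x)_+=\max(x,0)$. In each case below only the coordinates that change are described, and the result is $0$ if it is not in $B_l$. * $\tilde e_1$: ($\bar x_2{+}1,\bar x_1{-}1$) if $\bar x_2-\bar x_3\ge(x_2-x_3)_+$; ($x_3{+}1,\bar x_3{-}1$) if $\bar x_2-\bar x_3<0\le x_3-x_2$; ($x_1{+}1,x_2{-}1$) if $(\bar x_2-\bar x_3)_+<x_2-x_3$. * $\tilde f_1$: ($x_1{-}1,x_2{+}1$) if $(\bar x_2-\bar x_3)_+\le x_2-x_3$; ($x_3{-}1,\bar x_3{+}1$) if $\bar x_2-\bar x_3\le0<x_3-x_2$; ($\bar x_2{-}1,\bar x_1{+}1$) if $\bar x_2-\bar x_3>(x_2-x_3)_+$.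 * $\tilde e_2$: ($\bar x_3{+}2,\bar x_2{-}1$) if $\bar x_3\ge x_3$; ($x_2{+}1,x_3{-}2$) if $\bar x_3<x_3$. $\tilde f_2$: ($x_2{-}1,x_3{+}2$) if $\bar x_3\le x_3$; ($\bar x_3{-}2,\bar x_2{+}1$) if $\bar x_3>x_3$. * With $z_1=\bar x_1-x_1$, $z_2=\bar x_2-\bar x_3$, $z_3=x_3-x_2$, $z_4=(\bar x_3-x_3)/2$, the operator $\tilde f_0$ is ($x_1{+}1$) if $(F_1)$: $z_1+z_2+z_3+3z_4\le0$, $z_1+z_2+3z_4\le0$, $z_1+z_2\le0$, $z_1\le0$; ($x_3{+}1,\bar x_3{+}1,\bar x_1{-}1$) if $(F_2)$: $z_1+z_2+z_3+3z_4\le0$, $z_2+3z_4\le0$, $z_2\le0$, $z_1>0$; ($x_3{+}2,\bar x_2{-}1$) if $(F_3)$: $z_1+z_3+3z_4\le0$, $z_3+3z_4\le0$, $z_4\le0$, $z_2>0$, $z_1+z_2>0$; ($x_2{+}1,\bar x_3{-}2$) if $(F_4)$: $z_1+z_2+3z_4>0$, $z_2+3z_4>0$, $z_4>0$, $z_3\le0$,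 $z_1+z_3\le0$; ($x_1{+}1,x_3{-}1,\bar x_3{-}1$) if $(F_5)$: $z_1+z_2+z_3+3z_4>0$, $z_3+3z_4>0$, $z_3>0$, $z_1\le0$; ($\bar x_1{-}1$) if $(F_6)$: $z_1+z_2+z_3+3z_4>0$, $z_1+z_3+3z_4>0$, $z_1+z_3>0$, $z_1>0$. * Let $(E_k)$ be $(F_k)$ with every $>$ replaced by $\ge$ and every $\le$ replaced by $<$. Then $\tilde e_0$ makes the change opposite to the $k$-th one of $\tilde f_0$ if $(E_k)$ holds, $k=1,\dots,6$. On $B_l$ set $\varepsilon_a(b)=\max\{k:\tilde e_a^kb\ne0\}$ and $\varphi_a(b)=\max\{k:\tilde f_a^kb\ne0\}$. **The $U_q(A_2)$-crystal $B^{A_2}(j_0\Lambda_0+j_1\Lambda_1)$** ($j_0,j_1\in\mathbb Z_{\ge0}$; the simple roots of $A_2$ are indexed by $0,1$). It is the crystal of the irreducible module of highest weight $j_0\Lambda_0+j_1\Lambda_1$, realized as the set of semistandard two-row tableaux $t(p,q,r)$ with rows $1^{j_0+j_1-p-r}2^r3^p$ and $2^{j_1+p-q}3^{q-p}$, where $0\le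 p\le j_0$, $p\le q\le j_1+p$, $0\le r\le j_0-2p+q$. Here $\tilde e_0t(p,q,r)=t(p,q,r-1)$ if $r>0$, else $0$; $\tilde f_0t(p,q,r)=t(p,q,r+1)$ if $r<j_0+q-2p$, else $0$; $\tilde e_1t(p,q,r)=t(p-1,q-1,r+1)$ if $p>0$ and $p-q+r\ge0$, $=t(p,q-1,r)$ if $p-q+r<0$, and $=0$ otherwise; $\tilde f_1t(p,q,r)=t(p+1,q+1,r-1)$ if $q<p+r$, $=t(p,q+1,r)$ if $p+r\le q<j_1+p$, and $=0$ otherwise; $\varepsilon_0=r$, $\varphi_0=j_0-2p+q-r$, $\varepsilon_1=p+(q-p-r)_+$, $\varphi_1=(p-q+r)_++j_1+p-q$. Its highest weight element is $t(0,0,0)$. **Theorem.** For integers $i,j_0,j_1$ with $0\le i\le l/2$, $i\le j_0,j_1\le l-i$ and $j_0\equiv j_1\equiv l-i\pmod 3$, put $y_a=(l-i-j_a)/3$ and $$\bar b^{l,i}_{j_0,j_1}=\begin{cases}(0,\,y_1,\,-2y_1+3y_0+i,\,y_0+i,\,y_0+j_0,\,0)&\text{if }j_0\le j_1,\\(0,\,y_0,\,y_0+i,\,2y_1-y_0+i,\,-y_1+2y_0+j_0,\,0)&\text{if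 }j_0>j_1.\end{cases}$$ This is an element of $B_l$; let $B^{l,i}_{j_0,j_1}\subset B_l$ be the connected component of $\bar b^{l,i}_{j_0,j_1}$ in the crystal graph of $B_l$ with the $2$-arrows forgotten, i.e. with respect to $\tilde e_a,\tilde f_a$, $a=0,1$. Then $$B_l=\bigsqcup_{i=0}^{[l/2]}\ \bigsqcup_{\substack{i\le j_0,j_1\le l-i\\ j_0,j_1\equiv l-i\ (\mathrm{mod}\ 3)}}B^{l,i}_{j_0,j_1}$$ (a disjoint union), and for each such $(i,j_0,j_1)$ there is an isomorphism of $U_q(A_2)$-crystals $B^{A_2}(j_0\Lambda_0+j_1\Lambda_1)\cong B^{l,i}_{j_0,j_1}$, that is, a bijection that commutes with $\tilde e_a,\tilde f_a$ and preserves $\varepsilon_a,\varphi_a$ (hence the weight $\sum_a(\varphi_a-\varepsilon_a)\Lambda_a$) for $a=0,1$, under which the highest weight element $t(0,0,0)$ corresponds to $\bar b^{l,i}_{j_0,j_1}$. -/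

import Mathlib

/-! ### Crystals as coloured graphs with string lengths -/

/-- The data of a crystal with colour set `I`: Kashiwara operators `e i`, `f i` (the value `none`
is the element `0`) and the functions `ε i`, `φ i`. -/
structure CrystalData (I : Type) where
  carrier : Type
  e : I → carrier → Option carrier
  f : I → carrier → Option carrier
  ε : I → carrier → ℕ
  φ : I → carrier → ℕ

namespace CrystalData

variable {I J : Type}

/-- The weight `∑ i, (φ i b - ε i b) Λ_i`, as the family of its coefficients. -/
def wt (X : CrystalData I) (b : X.carrier) : I → ℤ :=
  fun i => (X.φ i b : ℤ) - (X.ε i b : ℤ)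

/-- Keep only the arrows whose colours are in the image of `c`. -/
def restrict (X : CrystalData I) (c : J → I) : CrystalData J where
  carrier := X.carrier
  e j := X.e (c j)
  f j := X.f (c j)
  ε j := X.ε (c j)
  φ j := X.φ (c j)

/-- There is an arrow from `b` to `b'` (given by some `e i` or some `f i`). -/
def Step (X : CrystalData I) (b b' : X.carrier) : Prop :=
  ∃ i, X.e i b = some b' ∨ X.f i b = some b'

/-- `b` and `b'` are joined by a path of arrows, in any direction. -/
def Linked (X : CrystalData I) (b b' : X.carrier) : Prop :=
  Relation.EqvGen X.Step b b'

/-- The vertex set of the connected component of `b₀`. -/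
def componentSet (X : CrystalData I) (b₀ : X.carrier) : Set X.carrier :=
  {b | X.Linked b₀ b}

/-- The connected component of `b₀`, with the structure inherited from `X`. -/
def component (X : CrystalData I) (b₀ : X.carrier) : CrystalData I where
  carrier := {b : X.carrier // b ∈ X.componentSet b₀}
  e i b := (X.e i b.1).pmap (fun b' hb' => ⟨b', hb'⟩)
    (fun _ h => Relation.EqvGen.trans _ _ _ b.2 (Relation.EqvGen.rel _ _ ⟨i, Or.inl h⟩))
  f i b := (X.f i b.1).pmap (fun b' hb' => ⟨b', hb'⟩)
    (fun _ h => Relation.EqvGen.trans _ _ _ b.2 (Relation.EqvGen.rel _ _ ⟨i, Or.inr h⟩))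
  ε i b := X.ε i b.1
  φ i b := X.φ i b.1

/-- The element `b₀` of its own connected component. -/
def componentBase (X : CrystalData I) (b₀ : X.carrier) : (X.component b₀).carrier :=
  ⟨b₀, Relation.EqvGen.refl b₀⟩

/-- Isomorphisms of crystals: bijections that commute with all `e i`, `f i` (where `0 ↦ 0`) and
preserve `ε i`, `φ i` (hence the weight). -/
structure Iso (X Y : CrystalData I) where
  toEquiv : X.carrier ≃ Y.carrier
  map_e : ∀ i b, Y.e i (toEquiv b) = (X.e i b).map toEquiv
  map_f : ∀ i b, Y.f i (toEquiv b) = (X.f i b).map toEquiv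
  map_ε : ∀ i b, Y.ε i (toEquiv b) = X.ε i b
  map_φ : ∀ i b, Y.φ i (toEquiv b) = X.φ i b

end CrystalData

/-- `op` applied `k` times to `b`, where `op 0 = 0`. -/
def iterOp {B : Type} (op : B → Option B) (k : ℕ) (b : B) : Option B :=
  (fun o : Option B => o.bind op)^[k] (some b)

/-- The string length `max {k | op ^ k b ≠ 0}`. -/
noncomputable def stringLength {B : Type} (op : B → Option B) (b : B) : ℕ :=
  sSup {k : ℕ | iterOp op k b ≠ none}

/-! ### The crystal `B_l` -/

/-- Coordinates `(x₁, x₂, x₃, x̄₃, x̄₂, x̄₁)`. -/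
@[ext]
structure Coord where
  x₁ : ℤ
  x₂ : ℤ
  x₃ : ℤ
  y₃ : ℤ
  y₂ : ℤ
  y₁ : ℤ

namespace Coord

/-- `s(b) = x₁ + x₂ + (x₃ + x̄₃)/2 + x̄₂ + x̄₁`. -/
def s (b : Coord) : ℤ := b.x₁ + b.x₂ + (b.x₃ + b.y₃) / 2 + b.y₂ + b.y₁

/-- Membership in `B_l`, the disjoint union over `0 ≤ j ≤ l` of the sets of all `b` with
nonnegative coordinates, `x₃ ≡ x̄₃ (mod 2)` and `s(b) = j`. -/
def Mem (l : ℕ) (b : Coord) : Prop :=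
  (0 ≤ b.x₁ ∧ 0 ≤ b.x₂ ∧ 0 ≤ b.x₃ ∧ 0 ≤ b.y₃ ∧ 0 ≤ b.y₂ ∧ 0 ≤ b.y₁) ∧
    b.x₃ % 2 = b.y₃ % 2 ∧ b.s ≤ l

instance (l : ℕ) (b : Coord) : Decidable (b.Mem l) := by
  unfold Mem; infer_instance

def z₁ (b : Coord) : ℤ := b.y₁ - b.x₁
def z₂ (b : Coord) : ℤ := b.y₂ - b.y₃
def z₃ (b : Coord) : ℤ := b.x₃ - b.x₂
def z₄ (b : Coord) : ℤ := (b.y₃ - b.x₃) / 2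

/-- The rule for `e₁`; the three cases are exhaustive. -/
def e₁ (b : Coord) : Option Coord :=
  if b.y₂ - b.y₃ ≥ max (b.x₂ - b.x₃) 0 then some { b with y₂ := b.y₂ + 1, y₁ := b.y₁ - 1 }
  else if b.y₂ - b.y₃ < 0 ∧ 0 ≤ b.x₃ - b.x₂ then
    some { b with x₃ := b.x₃ + 1, y₃ := b.y₃ - 1 }
  else if max (b.y₂ - b.y₃) 0 < b.x₂ - b.x₃ then
    some { b with x₁ := b.x₁ + 1, x₂ := b.x₂ - 1 }
  else none

/-- The rule for `f₁`; the three cases are exhaustive. -/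
def f₁ (b : Coord) : Option Coord :=
  if max (b.y₂ - b.y₃) 0 ≤ b.x₂ - b.x₃ then some { b with x₁ := b.x₁ - 1, x₂ := b.x₂ + 1 }
  else if b.y₂ - b.y₃ ≤ 0 ∧ 0 < b.x₃ - b.x₂ then
    some { b with x₃ := b.x₃ - 1, y₃ := b.y₃ + 1 }
  else if b.y₂ - b.y₃ > max (b.x₂ - b.x₃) 0 then
    some { b with y₂ := b.y₂ - 1, y₁ := b.y₁ + 1 }
  else none

def e₂ (b : Coord) : Option Coord :=
  if b.y₃ ≥ b.x₃ then some { b with y₃ := b.y₃ + 2, y₂ := b.y₂ - 1 }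
  else some { b with x₂ := b.x₂ + 1, x₃ := b.x₃ - 2 }

def f₂ (b : Coord) : Option Coord :=
  if b.y₃ ≤ b.x₃ then some { b with x₂ := b.x₂ - 1, x₃ := b.x₃ + 2 }
  else some { b with y₃ := b.y₃ - 2, y₂ := b.y₂ + 1 }

/-- The rule for `e₀`; the six cases are the conditions `(E₁)`, ..., `(E₆)`, which are
exhaustive and mutually exclusive on `B_l`. -/
def e₀ (b : Coord) : Option Coord :=
  if b.z₁ + b.z₂ + b.z₃ + 3 * b.z₄ < 0 ∧ b.z₁ + b.z₂ + 3 * b.z₄ < 0 ∧ b.z₁ + b.z₂ < 0 ∧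
      b.z₁ < 0 then
    some { b with x₁ := b.x₁ - 1 }
  else if b.z₁ + b.z₂ + b.z₃ + 3 * b.z₄ < 0 ∧ b.z₂ + 3 * b.z₄ < 0 ∧ b.z₂ < 0 ∧ b.z₁ ≥ 0 then
    some { b with x₃ := b.x₃ - 1, y₃ := b.y₃ - 1, y₁ := b.y₁ + 1 }
  else if b.z₁ + b.z₃ + 3 * b.z₄ < 0 ∧ b.z₃ + 3 * b.z₄ < 0 ∧ b.z₄ < 0 ∧ b.z₂ ≥ 0 ∧
      b.z₁ + b.z₂ ≥ 0 then
    some { b with x₃ := b.x₃ - 2, y₂ := b.y₂ + 1 }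
  else if b.z₁ + b.z₂ + 3 * b.z₄ ≥ 0 ∧ b.z₂ + 3 * b.z₄ ≥ 0 ∧ b.z₄ ≥ 0 ∧ b.z₃ < 0 ∧
      b.z₁ + b.z₃ < 0 then
    some { b with x₂ := b.x₂ - 1, y₃ := b.y₃ + 2 }
  else if b.z₁ + b.z₂ + b.z₃ + 3 * b.z₄ ≥ 0 ∧ b.z₃ + 3 * b.z₄ ≥ 0 ∧ b.z₃ ≥ 0 ∧ b.z₁ < 0 then
    some { b with x₁ := b.x₁ - 1, x₃ := b.x₃ + 1, y₃ := b.y₃ + 1 }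
  else if b.z₁ + b.z₂ + b.z₃ + 3 * b.z₄ ≥ 0 ∧ b.z₁ + b.z₃ + 3 * b.z₄ ≥ 0 ∧ b.z₁ + b.z₃ ≥ 0 ∧
      b.z₁ ≥ 0 then
    some { b with y₁ := b.y₁ + 1 }
  else none

/-- The rule for `f₀`; the six cases are the conditions `(F₁)`, ..., `(F₆)`, which are
exhaustive and mutually exclusive on `B_l`. -/
def f₀ (b : Coord) : Option Coord :=
  if b.z₁ + b.z₂ + b.z₃ + 3 * b.z₄ ≤ 0 ∧ b.z₁ + b.z₂ + 3 * b.z₄ ≤ 0 ∧ b.z₁ + b.z₂ ≤ 0 ∧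
      b.z₁ ≤ 0 then
    some { b with x₁ := b.x₁ + 1 }
  else if b.z₁ + b.z₂ + b.z₃ + 3 * b.z₄ ≤ 0 ∧ b.z₂ + 3 * b.z₄ ≤ 0 ∧ b.z₂ ≤ 0 ∧ b.z₁ > 0 then
    some { b with x₃ := b.x₃ + 1, y₃ := b.y₃ + 1, y₁ := b.y₁ - 1 }
  else if b.z₁ + b.z₃ + 3 * b.z₄ ≤ 0 ∧ b.z₃ + 3 * b.z₄ ≤ 0 ∧ b.z₄ ≤ 0 ∧ b.z₂ > 0 ∧
      b.z₁ + b.z₂ > 0 then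
    some { b with x₃ := b.x₃ + 2, y₂ := b.y₂ - 1 }
  else if b.z₁ + b.z₂ + 3 * b.z₄ > 0 ∧ b.z₂ + 3 * b.z₄ > 0 ∧ b.z₄ > 0 ∧ b.z₃ ≤ 0 ∧
      b.z₁ + b.z₃ ≤ 0 then
    some { b with x₂ := b.x₂ + 1, y₃ := b.y₃ - 2 }
  else if b.z₁ + b.z₂ + b.z₃ + 3 * b.z₄ > 0 ∧ b.z₃ + 3 * b.z₄ > 0 ∧ b.z₃ > 0 ∧ b.z₁ ≤ 0 then
    some { b with x₁ := b.x₁ + 1, x₃ := b.x₃ - 1, y₃ := b.y₃ - 1 }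
  else if b.z₁ + b.z₂ + b.z₃ + 3 * b.z₄ > 0 ∧ b.z₁ + b.z₃ + 3 * b.z₄ > 0 ∧ b.z₁ + b.z₃ > 0 ∧
      b.z₁ > 0 then
    some { b with y₁ := b.y₁ - 1 }
  else none

end Coord

/-- The underlying set of `B_l`. -/
abbrev BSet (l : ℕ) : Type := {b : Coord // b.Mem l}

/-- An element of `B_l`, or `0` if the coordinates are not those of an element of `B_l`. -/
def toBSet (l : ℕ) (b : Coord) : Option (BSet l) :=
  if h : b.Mem l then some ⟨b, h⟩ else none

/-- The operators `e_i` of `B_l` for `i = 0, 1, 2`. -/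
def eB (l : ℕ) (i : Fin 3) (b : BSet l) : Option (BSet l) :=
  (match i with
    | 0 => b.1.e₀
    | 1 => b.1.e₁
    | 2 => b.1.e₂).bind (toBSet l)

/-- The operators `f_i` of `B_l` for `i = 0, 1, 2`. -/
def fB (l : ℕ) (i : Fin 3) (b : BSet l) : Option (BSet l) :=
  (match i with
    | 0 => b.1.f₀
    | 1 => b.1.f₁
    | 2 => b.1.f₂).bind (toBSet l)

/-- The crystal `B_l` of type `D₄⁽³⁾`, with colours `0, 1, 2`. -/
noncomputable def crystalB (l : ℕ) : CrystalData (Fin 3) where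
  carrier := BSet l
  e := eB l
  f := fB l
  ε i := stringLength (eB l i)
  φ i := stringLength (fB l i)

/-- `B_l` with its `2`-arrows forgotten: a crystal with colours `0, 1`. -/
noncomputable def crystalB01 (l : ℕ) : CrystalData (Fin 2) :=
  (crystalB l).restrict Fin.castSucc

/-! ### The elements `b̄` -/

/-- The triples `(i, j₀, j₁)` with `0 ≤ i ≤ l/2`, `i ≤ j₀, j₁ ≤ l - i` and
`j₀ ≡ j₁ ≡ l - i (mod 3)`. -/
@[ext]
structure DecompIndex (l : ℕ) where
  i : ℕ
  j₀ : ℕ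
  j₁ : ℕ
  two_mul_i_le : 2 * i ≤ l
  i_le_j₀ : i ≤ j₀
  j₀_le : j₀ ≤ l - i
  i_le_j₁ : i ≤ j₁
  j₁_le : j₁ ≤ l - i
  j₀_mod : j₀ ≡ l - i [MOD 3]
  j₁_mod : j₁ ≡ l - i [MOD 3]

/-- The coordinates of `b̄`, with `Y₀ = (l - i - j₀)/3` and `Y₁ = (l - i - j₁)/3`. -/
def bBarCoord (l i j₀ j₁ : ℤ) : Coord :=
  let Y₀ := (l - i - j₀) / 3
  let Y₁ := (l - i - j₁) / 3
  if j₀ ≤ j₁ then ⟨0, Y₁, -2 * Y₁ + 3 * Y₀ + i, Y₀ + i, Y₀ + j₀, 0⟩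
  else ⟨0, Y₀, Y₀ + i, 2 * Y₁ - Y₀ + i, -Y₁ + 2 * Y₀ + j₀, 0⟩

theorem bBarCoord_mem {l : ℕ} (d : DecompIndex l) :
    (bBarCoord l d.i d.j₀ d.j₁).Mem l := by
  obtain ⟨i, j₀, j₁, h1, h2, h3, h4, h5, h6, h7⟩ := d
  simp only [Nat.ModEq] at h6 h7
  simp only [bBarCoord, Coord.Mem]
  split_ifs <;> simp only [Coord.s] <;> omega

/-- The element `b̄` of `B_l`. -/
def bBar {l : ℕ} (d : DecompIndex l) : BSet l :=
  ⟨bBarCoord l d.i d.j₀ d.j₁, bBarCoord_mem d⟩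

/-! ### The highest weight crystals of type `A₂` -/

/-- The elements `t(p, q, r)` of the crystal of highest weight `j₀Λ₀ + j₁Λ₁`: the semistandard
two-row tableau with first row `1^(j₀+j₁-p-r) 2^r 3^p` and second row `2^(j₁+p-q) 3^(q-p)`. -/
@[ext]
structure TabA2 (j₀ j₁ : ℕ) where
  p : ℕ
  q : ℕ
  r : ℕ
  p_le : p ≤ j₀
  p_le_q : p ≤ q
  q_le : q ≤ j₁ + p
  r_le : r + 2 * p ≤ j₀ + q

namespace TabA2

variable {j₀ j₁ : ℕ}

def e₀ (t : TabA2 j₀ j₁) : Option (TabA2 j₀ j₁) :=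
  if 0 < t.r then
    some ⟨t.p, t.q, t.r - 1, t.p_le, t.p_le_q, t.q_le, by have := t.r_le; omega⟩
  else none

def e₁ (t : TabA2 j₀ j₁) : Option (TabA2 j₀ j₁) :=
  if h : t.q ≤ t.p + t.r then
    if h' : 0 < t.p then
      some ⟨t.p - 1, t.q - 1, t.r + 1, by have := t.p_le; omega, by have := t.p_le_q; omega,
        by have := t.q_le; omega, by have := t.r_le; have := t.p_le_q; omega⟩
    else none
  else
    some ⟨t.p, t.q - 1, t.r, t.p_le, by omega, by have := t.q_le; omega,
      by have := t.p_le; omega⟩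

def f₀ (t : TabA2 j₀ j₁) : Option (TabA2 j₀ j₁) :=
  if h : t.r + 2 * t.p < j₀ + t.q then
    some ⟨t.p, t.q, t.r + 1, t.p_le, t.p_le_q, t.q_le, by omega⟩
  else none

def f₁ (t : TabA2 j₀ j₁) : Option (TabA2 j₀ j₁) :=
  if h : t.q < t.p + t.r then
    some ⟨t.p + 1, t.q + 1, t.r - 1, by have := t.r_le; omega, by have := t.p_le_q; omega,
      by have := t.q_le; omega, by have := t.r_le; have := t.p_le_q; omega⟩
  else if h' : t.q < j₁ + t.p then
    some ⟨t.p, t.q + 1, t.r, t.p_le, by have := t.p_le_q; omega, by omega,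
      by have := t.r_le; omega⟩
  else none

/-- The highest weight element `t(0, 0, 0)`. -/
def top (j₀ j₁ : ℕ) : TabA2 j₀ j₁ :=
  ⟨0, 0, 0, by omega, by omega, by omega, by omega⟩

end TabA2

/-- The crystal `B^{A₂}(j₀Λ₀ + j₁Λ₁)` of the irreducible highest weight module, with colours
`0, 1`, in the realization by two-row tableaux. Here `ε₀ = r`, `ε₁ = p + (q-p-r)₊`,
`φ₀ = j₀ - 2p + q - r`, `φ₁ = (p-q+r)₊ + j₁ + p - q`; the truncated subtractions of natural
numbers below have these values. -/
def crystalA2 (j₀ j₁ : ℕ) : CrystalData (Fin 2) where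
  carrier := TabA2 j₀ j₁
  e i := match i with
    | 0 => TabA2.e₀
    | 1 => TabA2.e₁
  f i := match i with
    | 0 => TabA2.f₀
    | 1 => TabA2.f₁
  ε i t := match i with
    | 0 => t.r
    | 1 => t.p + (t.q - (t.p + t.r))
  φ i t := match i with
    | 0 => j₀ + t.q - (2 * t.p + t.r)
    | 1 => (t.p + t.r - t.q) + (j₁ + t.p - t.q)

/-! ### Local axioms for crystals of type `A₂` -/

/-! The argument is Stembridge's: a crystal of type A₂ is determined by local relations between its
two operators. `LocalA2` lists such relations, and two things follow from them. If `h` is a highest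
weight vertex of weight `j₀Λ₀ + j₁Λ₁`, then the vertices `F₀^r F₁^q F₀^p h`, with `(p, q, r)` in the
tableau range, are closed under the operators. Moreover ε, φ and the action of `F₁` on them are
given by the tableau formulas (`ε₁_stringVertex`, `F₁_lower`, `F₁_upper`). The diagonal `r = q - p`
separates two regimes of `F₁`: squares propagate the action inside each regime, and the octagon
relation crosses the diagonal.

The operators of `B_l` extend to bijections of ℤ⁶ that are piecewise translations, and the strings
have piecewise linear lengths `eps₀`, `phi₀`, `eps₁`, `phi₁`. Hence every local relation is a finite
check over linear regions (`Coord.localA2`).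

Finally, `eps₀ = eps₁ = 0` forces a vertex of `B_l` to be one of the `b̄` (`Mem.exists_eq_bBar`).
Each raising operator increases the bounded quantity `wt₀ + wt₁` by one, so every vertex lies below
some `b̄` (`exists_ofTab_eq`). Since a vertex determines both its tableau and its highest weight
vertex (`tab_unique`), the components are disjoint. -/

/-- Local axioms, in the manner of Stembridge, for a pair of injective maps `F₀`, `F₁` on a set `X`
with a subset `M` (the vertices of the crystal) and functions `ε₀`, `φ₀`, `ε₁`, `φ₁`. -/
structure LocalA2 {X : Type} (F₀ F₁ : X → X) (ε₀ φ₀ ε₁ φ₁ : X → ℤ) (M : X → Prop) : Prop where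
  inj₀ : Function.Injective F₀
  inj₁ : Function.Injective F₁
  ε₀_nonneg : ∀ x, M x → 0 ≤ ε₀ x
  ε₁_nonneg : ∀ x, M x → 0 ≤ ε₁ x
  mem_F₀ : ∀ x, M x → (M (F₀ x) ↔ 0 < φ₀ x)
  mem_F₁ : ∀ x, M x → (M (F₁ x) ↔ 0 < φ₁ x)
  -- From here on the laws hold at every point of `X`, so paths may be compared without checking
  -- that they stay in `M`.
  ε₀_F₀ : ∀ x, ε₀ (F₀ x) = ε₀ x + 1
  ε₁_F₁ : ∀ x, ε₁ (F₁ x) = ε₁ x + 1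
  wt₀_F₀ : ∀ x, φ₀ (F₀ x) - ε₀ (F₀ x) = φ₀ x - ε₀ x - 2
  wt₀_F₁ : ∀ x, φ₀ (F₁ x) - ε₀ (F₁ x) = φ₀ x - ε₀ x + 1
  wt₁_F₀ : ∀ x, φ₁ (F₀ x) - ε₁ (F₀ x) = φ₁ x - ε₁ x + 1
  wt₁_F₁ : ∀ x, φ₁ (F₁ x) - ε₁ (F₁ x) = φ₁ x - ε₁ x - 2
  ε₀_F₁_le : ∀ x, ε₀ (F₁ x) ≤ ε₀ x
  ε₁_F₀_le : ∀ x, ε₁ (F₀ x) ≤ ε₁ x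
  -- A step that keeps the other ε is followed, in the other colour, by a step that lowers its own ε
  -- back.
  drop₀ : ∀ x, ε₁ (F₀ x) = ε₁ x → ε₀ (F₁ (F₀ x)) = ε₀ x
  drop₁ : ∀ x, ε₀ (F₁ x) = ε₀ x → ε₁ (F₀ (F₁ x)) = ε₁ x
  square₀ : ∀ x, ε₁ (F₀ x) = ε₁ x - 1 → F₀ (F₁ x) = F₁ (F₀ x)
  square₁ : ∀ x, ε₀ (F₁ x) = ε₀ x - 1 → F₀ (F₁ x) = F₁ (F₀ x)
  octagon : ∀ x, ε₁ (F₀ x) = ε₁ x → ε₀ (F₁ x) = ε₀ x →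
    F₀ (F₁ (F₁ (F₀ x))) = F₁ (F₀ (F₀ (F₁ x)))

/-! ### Strings: ε, weight and membership along iterates. -/

namespace LocalA2

variable {X : Type} {F₀ F₁ : X → X} {ε₀ φ₀ ε₁ φ₁ : X → ℤ} {M : X → Prop}

theorem ε₀_iterate (A : LocalA2 F₀ F₁ ε₀ φ₀ ε₁ φ₁ M) (n : ℕ) (x : X) :
    ε₀ (F₀^[n] x) = ε₀ x + n := by
  induction n with
  | zero => simp
  | succ n ih => rw [Function.iterate_succ_apply', A.ε₀_F₀, ih]; push_cast; ring

theorem ε₁_iterate (A : LocalA2 F₀ F₁ ε₀ φ₀ ε₁ φ₁ M) (n : ℕ) (x : X) :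
    ε₁ (F₁^[n] x) = ε₁ x + n := by
  induction n with
  | zero => simp
  | succ n ih => rw [Function.iterate_succ_apply', A.ε₁_F₁, ih]; push_cast; ring

theorem wt₀_iterate₀ (A : LocalA2 F₀ F₁ ε₀ φ₀ ε₁ φ₁ M) (n : ℕ) (x : X) :
    φ₀ (F₀^[n] x) - ε₀ (F₀^[n] x) = φ₀ x - ε₀ x - 2 * n := by
  induction n with
  | zero => simp
  | succ n ih => rw [Function.iterate_succ_apply', A.wt₀_F₀, ih]; push_cast; ring

theorem wt₀_iterate₁ (A : LocalA2 F₀ F₁ ε₀ φ₀ ε₁ φ₁ M) (n : ℕ) (x : X) :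
    φ₀ (F₁^[n] x) - ε₀ (F₁^[n] x) = φ₀ x - ε₀ x + n := by
  induction n with
  | zero => simp
  | succ n ih => rw [Function.iterate_succ_apply', A.wt₀_F₁, ih]; push_cast; ring

theorem wt₁_iterate₀ (A : LocalA2 F₀ F₁ ε₀ φ₀ ε₁ φ₁ M) (n : ℕ) (x : X) :
    φ₁ (F₀^[n] x) - ε₁ (F₀^[n] x) = φ₁ x - ε₁ x + n := by
  induction n with
  | zero => simp
  | succ n ih => rw [Function.iterate_succ_apply', A.wt₁_F₀, ih]; push_cast; ring

theorem wt₁_iterate₁ (A : LocalA2 F₀ F₁ ε₀ φ₀ ε₁ φ₁ M) (n : ℕ) (x : X) :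
    φ₁ (F₁^[n] x) - ε₁ (F₁^[n] x) = φ₁ x - ε₁ x - 2 * n := by
  induction n with
  | zero => simp
  | succ n ih => rw [Function.iterate_succ_apply', A.wt₁_F₁, ih]; push_cast; ring

theorem mem_iterate₀ (A : LocalA2 F₀ F₁ ε₀ φ₀ ε₁ φ₁ M) (n : ℕ) (x : X) (hx : M x)
    (hn : (n : ℤ) ≤ φ₀ x) : M (F₀^[n] x) := by
  induction n with
  | zero => exact hx
  | succ n ih =>
    push_cast at hn
    rw [Function.iterate_succ_apply', A.mem_F₀ _ (ih (by omega))]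
    have h1 := A.wt₀_iterate₀ n x
    have h2 := A.ε₀_iterate n x
    omega

theorem mem_iterate₁ (A : LocalA2 F₀ F₁ ε₀ φ₀ ε₁ φ₁ M) (n : ℕ) (x : X) (hx : M x)
    (hn : (n : ℤ) ≤ φ₁ x) : M (F₁^[n] x) := by
  induction n with
  | zero => exact hx
  | succ n ih =>
    push_cast at hn
    rw [Function.iterate_succ_apply', A.mem_F₁ _ (ih (by omega))]
    have h1 := A.wt₁_iterate₁ n x
    have h2 := A.ε₁_iterate n x
    omega

theorem ε₀_iterate₁_le (A : LocalA2 F₀ F₁ ε₀ φ₀ ε₁ φ₁ M) (n : ℕ) (x : X) :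
    ε₀ (F₁^[n] x) ≤ ε₀ x := by
  induction n with
  | zero => simp
  | succ n ih => rw [Function.iterate_succ_apply']; exact (A.ε₀_F₁_le _).trans ih

theorem ε₁_iterate₀_le (A : LocalA2 F₀ F₁ ε₀ φ₀ ε₁ φ₁ M) (n : ℕ) (x : X) :
    ε₁ (F₀^[n] x) ≤ ε₁ x := by
  induction n with
  | zero => simp
  | succ n ih => rw [Function.iterate_succ_apply']; exact (A.ε₁_F₀_le _).trans ih

end LocalA2

/-! ### The vertices below a highest weight vertex. -/

/-- A highest weight vertex `h` of weight `j₀Λ₀ + j₁Λ₁`. -/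
structure IsHighest {X : Type} (ε₀ φ₀ ε₁ φ₁ : X → ℤ) (M : X → Prop) (j₀ j₁ : ℕ) (h : X) :
    Prop where
  mem : M h
  ε₀_eq : ε₀ h = 0
  ε₁_eq : ε₁ h = 0
  φ₀_eq : φ₀ h = j₀
  φ₁_eq : φ₁ h = j₁

/-- The vertex `F₀^r F₁^q F₀^p h`, which corresponds to the tableau `t(p, q, r)`. -/
def stringVertex {X : Type} (F₀ F₁ : X → X) (h : X) (p q r : ℕ) : X :=
  F₀^[r] (F₁^[q] (F₀^[p] h))

section

variable {X : Type} {F₀ F₁ : X → X} {ε₀ φ₀ ε₁ φ₁ : X → ℤ} {M : X → Prop} {j₀ j₁ : ℕ} {h : X}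

local notation "T" => stringVertex F₀ F₁ h

variable (F₀) in
theorem F₀_stringVertex (p q r : ℕ) : F₀ (T p q r) = T p q (r + 1) := by
  simp only [stringVertex, Function.iterate_succ_apply']

variable (F₁) in
theorem F₁_stringVertex_zero (p q : ℕ) : F₁ (T p q 0) = T p (q + 1) 0 := by
  simp only [stringVertex, Function.iterate_succ_apply', Function.iterate_zero, id]

namespace LocalA2

theorem mem_first (A : LocalA2 F₀ F₁ ε₀ φ₀ ε₁ φ₁ M) (H : IsHighest ε₀ φ₀ ε₁ φ₁ M j₀ j₁ h)
    {p : ℕ} (hp : p ≤ j₀) : M (F₀^[p] h) :=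
  A.mem_iterate₀ p h H.mem (by rw [H.φ₀_eq]; exact_mod_cast hp)

/-- `F₀` never raises ε₁, which starts at 0 and cannot be negative inside `M`. -/
theorem ε₁_first (A : LocalA2 F₀ F₁ ε₀ φ₀ ε₁ φ₁ M) (H : IsHighest ε₀ φ₀ ε₁ φ₁ M j₀ j₁ h)
    {p : ℕ} (hp : p ≤ j₀) : ε₁ (F₀^[p] h) = 0 := by
  have h1 := A.ε₁_iterate₀_le p h
  have h2 := A.ε₁_nonneg _ (A.mem_first H hp)
  have h3 := H.ε₁_eq
  omega

theorem ε₁_second (A : LocalA2 F₀ F₁ ε₀ φ₀ ε₁ φ₁ M) (H : IsHighest ε₀ φ₀ ε₁ φ₁ M j₀ j₁ h)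
    {p : ℕ} (hp : p ≤ j₀) (q : ℕ) : ε₁ (T p q 0) = q := by
  have h1 := A.ε₁_iterate q (F₀^[p] h)
  rw [A.ε₁_first H hp] at h1
  simpa [stringVertex] using h1

theorem mem_second (A : LocalA2 F₀ F₁ ε₀ φ₀ ε₁ φ₁ M) (H : IsHighest ε₀ φ₀ ε₁ φ₁ M j₀ j₁ h)
    {p q : ℕ} (hp : p ≤ j₀) (hq : q ≤ j₁ + p) : M (T p q 0) := by
  refine A.mem_iterate₁ q _ (A.mem_first H hp) ?_
  have h1 := A.ε₁_first H hp
  have h2 := A.wt₁_iterate₀ p h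
  have h3 := H.φ₁_eq
  have h4 := H.ε₁_eq
  omega

/-- Along `F₁^j F₀^p h` with `j ≤ p`, the maps `F₀` and `F₁` commute and `F₁` lowers `ε₀`. -/
theorem first_triangle (A : LocalA2 F₀ F₁ ε₀ φ₀ ε₁ φ₁ M)
    (H : IsHighest ε₀ φ₀ ε₁ φ₁ M j₀ j₁ h) (j : ℕ) : ∀ p, j ≤ p → p ≤ j₀ →
      T p j 1 = T (p + 1) j 0 ∧ ε₀ (T p j 0) = p - j := by
  induction j with
  | zero =>
    intro p _ _
    have h1 := A.ε₀_iterate p h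
    rw [H.ε₀_eq] at h1
    refine ⟨by simp [stringVertex, Function.iterate_succ_apply'], by simpa [stringVertex] using h1⟩
  | succ j ih =>
    intro p hjp hp
    obtain ⟨p, rfl⟩ : ∃ p', p = p' + 1 := ⟨p - 1, by omega⟩
    obtain ⟨e1, d1⟩ := ih p (by omega) (by omega)
    obtain ⟨e2, d2⟩ := ih (p + 1) (by omega) hp
    -- After `j` steps of `F₁` from a vertex with ε₁ = 0, ε₁ equals `j` whatever `p` is; so `F₀`
    -- keeps ε₁ here.
    have k := A.drop₀ (T p j 0) (by
      rw [F₀_stringVertex F₀, e1, A.ε₁_second H hp, A.ε₁_second H (by omega)])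
    rw [F₀_stringVertex F₀, e1, F₁_stringVertex_zero F₁] at k
    refine ⟨?_, by rw [k, d1]; push_cast; ring⟩
    -- ε₀ falls from `p + 1 - j` to `p - j`, so `F₀` and `F₁` commute at this vertex.
    have k2 := A.square₁ (T (p + 1) j 0) (by
      rw [F₁_stringVertex_zero F₁, k, d1, d2]; push_cast; ring)
    rw [F₁_stringVertex_zero F₁, F₀_stringVertex F₀, F₀_stringVertex F₀, e2,
        F₁_stringVertex_zero F₁] at k2
    exact k2

/-- The triangle ends with ε₀ = 0 at `q = p`. Further `F₁` steps cannot raise it, and `k ≤ j₁` keeps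
the vertex in `M`, where it cannot be negative. -/
theorem ε₀_second (A : LocalA2 F₀ F₁ ε₀ φ₀ ε₁ φ₁ M) (H : IsHighest ε₀ φ₀ ε₁ φ₁ M j₀ j₁ h)
    {p k : ℕ} (hp : p ≤ j₀) (hk : k ≤ j₁) : ε₀ (T p (p + k) 0) = 0 := by
  have h1 := A.ε₀_iterate₁_le k (T p p 0)
  have h2 := (A.first_triangle H p p le_rfl hp).2
  have h3 := A.ε₀_nonneg _ (A.mem_second H hp (q := p + k) (by omega))
  have h4 : F₁^[k] (T p p 0) = T p (p + k) 0 := by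
    simp only [stringVertex, Function.iterate_zero, id]
    rw [← Function.iterate_add_apply, add_comm]
  rw [h4] at h1
  omega

theorem ε₀_stringVertex (A : LocalA2 F₀ F₁ ε₀ φ₀ ε₁ φ₁ M)
    (H : IsHighest ε₀ φ₀ ε₁ φ₁ M j₀ j₁ h)
    {p k : ℕ} (hp : p ≤ j₀) (hk : k ≤ j₁) (r : ℕ) : ε₀ (T p (p + k) r) = r := by
  have h1 := A.ε₀_iterate r (T p (p + k) 0)
  rw [A.ε₀_second H hp hk] at h1
  simpa [stringVertex] using h1

theorem wt₀_stringVertex (A : LocalA2 F₀ F₁ ε₀ φ₀ ε₁ φ₁ M)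
    (H : IsHighest ε₀ φ₀ ε₁ φ₁ M j₀ j₁ h) (p q r : ℕ) :
    φ₀ (T p q r) - ε₀ (T p q r) = j₀ - 2 * p + q - 2 * r := by
  have h1 := A.wt₀_iterate₀ p h
  have h2 := A.wt₀_iterate₁ q (F₀^[p] h)
  have h3 := A.wt₀_iterate₀ r (F₁^[q] (F₀^[p] h))
  have h4 := H.φ₀_eq
  have h5 := H.ε₀_eq
  simp only [stringVertex]
  omega

theorem wt₁_stringVertex (A : LocalA2 F₀ F₁ ε₀ φ₀ ε₁ φ₁ M)
    (H : IsHighest ε₀ φ₀ ε₁ φ₁ M j₀ j₁ h) (p q r : ℕ) :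
    φ₁ (T p q r) - ε₁ (T p q r) = j₁ + p - 2 * q + r := by
  have h1 := A.wt₁_iterate₀ p h
  have h2 := A.wt₁_iterate₁ q (F₀^[p] h)
  have h3 := A.wt₁_iterate₀ r (F₁^[q] (F₀^[p] h))
  have h4 := H.φ₁_eq
  have h5 := H.ε₁_eq
  simp only [stringVertex]
  omega

theorem mem_stringVertex (A : LocalA2 F₀ F₁ ε₀ φ₀ ε₁ φ₁ M)
    (H : IsHighest ε₀ φ₀ ε₁ φ₁ M j₀ j₁ h)
    {p k r : ℕ} (hp : p ≤ j₀) (hk : k ≤ j₁) (hr : r + p ≤ j₀ + k) : M (T p (p + k) r) := by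
  refine A.mem_iterate₀ r (T p (p + k) 0) (A.mem_second H hp (by omega)) ?_
  have h1 := A.wt₀_stringVertex H p (p + k) 0
  have h2 := A.ε₀_second H hp hk
  push_cast at h1
  omega

/-- Below the diagonal `r ≤ q - p`. -/
theorem lower_strings (A : LocalA2 F₀ F₁ ε₀ φ₀ ε₁ φ₁ M)
    (H : IsHighest ε₀ φ₀ ε₁ φ₁ M j₀ j₁ h) {p : ℕ} (hp : p ≤ j₀) (k : ℕ) (hk : k ≤ j₁) :
    ∀ r, r ≤ k → ε₁ (T p (p + k) r) = p + k - r ∧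
      F₁ (T p (p + k) r) = T p (p + k + 1) r := by
  induction k with
  | zero =>
    intro r hr
    obtain rfl : r = 0 := by omega
    exact ⟨by rw [A.ε₁_second H hp]; push_cast; ring, F₁_stringVertex_zero F₁ _ _⟩
  | succ k ih =>
    have ih := ih (by omega)
    have hε : ∀ r, r ≤ k + 1 → ε₁ (T p (p + (k + 1)) r) = p + ((k + 1 : ℕ) : ℤ) - r := by
      intro r hr
      rcases Nat.lt_or_ge k r with hlt | hge
      · obtain rfl : r = k + 1 := by omega
        obtain ⟨i1, i2⟩ := ih k le_rfl
        -- On the diagonal `F₁` keeps ε₀ = `k`, so the next `F₀` brings ε₁ back to `p`; this gives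
        -- the value at the new diagonal vertex.
        have h1 := A.drop₁ (T p (p + k) k) (by
          rw [i2, A.ε₀_stringVertex H hp (by omega), add_assoc,
            A.ε₀_stringVertex H hp (by omega)])
        rw [i2, F₀_stringVertex F₀, i1] at h1
        rw [← add_assoc, h1]; push_cast; ring
      · obtain ⟨i1, i2⟩ := ih r hge
        have h1 := A.ε₁_F₁ (T p (p + k) r)
        rw [i2, i1] at h1
        rw [← add_assoc, h1]; push_cast; ring
    intro r
    induction r with
    | zero => exact fun _ => ⟨hε 0 (by omega), F₁_stringVertex_zero F₁ _ _⟩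
    | succ r ihr =>
      intro hr
      have h1 := (ihr (by omega)).2
      refine ⟨hε _ hr, ?_⟩
      -- Up to the diagonal each `F₀` lowers ε₁ by one, so `F₁` moves past it.
      have h2 := A.square₀ (T p (p + (k + 1)) r) (by
        rw [F₀_stringVertex F₀, hε _ hr, hε r (by omega)]; push_cast; ring)
      rw [h1, F₀_stringVertex F₀, F₀_stringVertex F₀] at h2
      exact h2.symm

/-- Above the diagonal: the action of `F₁` where `q - p < r`, given `ε₁` where `q - p ≤ r`. -/
theorem upper_step (A : LocalA2 F₀ F₁ ε₀ φ₀ ε₁ φ₁ M)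
    (H : IsHighest ε₀ φ₀ ε₁ φ₁ M j₀ j₁ h) {p : ℕ} (hp : p + 1 ≤ j₀)
    (hε : ∀ k r, k ≤ j₁ → k ≤ r → r + p ≤ j₀ + k → ε₁ (T p (p + k) r) = p)
    (k : ℕ) (hk : k ≤ j₁) :
    ∀ r, k ≤ r → r + 1 + p ≤ j₀ + k → F₁ (T p (p + k) (r + 1)) = T (p + 1) (p + 1 + k) r := by
  -- The first vertex past the diagonal. Both operators keep the other ε at the diagonal vertex `T p
  -- (p + k) k`, so the octagon there carries the claim from `k` to `k + 1`.
  have base : F₁ (T p (p + k) (k + 1)) = T (p + 1) (p + 1 + k) k := by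
    induction k with
    | zero =>
      rw [add_zero, (A.first_triangle H p p le_rfl (by omega)).1]
      exact F₁_stringVertex_zero F₁ _ _
    | succ k ih =>
      have ih := ih (by omega)
      have l1 := (A.lower_strings H (p := p) (by omega) k (by omega) k le_rfl).2
      have l2 := (A.lower_strings H (p := p + 1) hp k (by omega) k le_rfl).2
      have h1 := A.octagon (T p (p + k) k)
        (by rw [F₀_stringVertex F₀, hε k k (by omega) le_rfl (by omega),
              hε k (k + 1) (by omega) (by omega) (by omega)])
        (by rw [l1, A.ε₀_stringVertex H (by omega) (by omega), add_assoc,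
              A.ε₀_stringVertex H (by omega) (by omega)])
      rw [F₀_stringVertex F₀, ih, l2, F₀_stringVertex F₀, l1, F₀_stringVertex F₀,
        F₀_stringVertex F₀] at h1
      exact h1.symm
  intro r hr
  induction r, hr using Nat.le_induction with
  | base => exact fun _ => base
  | succ r hr ih =>
    intro hr'
    have h1 := ih (by omega)
    -- Further up, `F₁` lowers ε₀ from `r + 1` to `r`, and squares suffice.
    have h2 := A.square₁ (T p (p + k) (r + 1)) (by
      rw [h1, A.ε₀_stringVertex H hp hk, A.ε₀_stringVertex H (by omega) hk]; push_cast; ring)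
    rw [h1, F₀_stringVertex F₀, F₀_stringVertex F₀] at h2
    exact h2.symm

/-- This interlocks with `upper_step`, which needs the value at `p` and produces the vertices for `p
+ 1` as images under `F₁`. For `p = 0`, ε₁ is already 0 on the diagonal and stays there. -/
theorem ε₁_upper (A : LocalA2 F₀ F₁ ε₀ φ₀ ε₁ φ₁ M)
    (H : IsHighest ε₀ φ₀ ε₁ φ₁ M j₀ j₁ h) {p : ℕ} (hp : p ≤ j₀) :
    ∀ k r, k ≤ j₁ → k ≤ r → r + p ≤ j₀ + k → ε₁ (T p (p + k) r) = p := by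
  induction p with
  | zero =>
    intro k r hk hkr hr
    have h1 := (A.lower_strings H hp k hk k le_rfl).1
    have h2 := A.ε₁_nonneg _ (A.mem_stringVertex H hp hk hr)
    have h3 := A.ε₁_iterate₀_le (r - k) (T 0 (0 + k) k)
    have h4 : F₀^[r - k] (T 0 (0 + k) k) = T 0 (0 + k) r := by
      simp only [stringVertex]
      rw [← Function.iterate_add_apply, Nat.sub_add_cancel hkr]
    rw [h4] at h3
    push_cast at *
    omega
  | succ p ih =>
    intro k r hk hkr hr
    have i := ih (by omega)
    rw [← A.upper_step H hp i k hk r hkr (by omega), A.ε₁_F₁,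
      i k (r + 1) hk (by omega) (by omega)]
    push_cast; ring

theorem F₁_lower (A : LocalA2 F₀ F₁ ε₀ φ₀ ε₁ φ₁ M) (H : IsHighest ε₀ φ₀ ε₁ φ₁ M j₀ j₁ h)
    {p q r : ℕ} (hp : p ≤ j₀) (hq : q ≤ j₁ + p) (hr : p + r ≤ q) :
    F₁ (T p q r) = T p (q + 1) r := by
  obtain ⟨k, rfl⟩ : ∃ k, q = p + k := ⟨q - p, by omega⟩
  exact (A.lower_strings H hp k (by omega) r (by omega)).2

theorem F₁_upper (A : LocalA2 F₀ F₁ ε₀ φ₀ ε₁ φ₁ M) (H : IsHighest ε₀ φ₀ ε₁ φ₁ M j₀ j₁ h)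
    {p q r : ℕ} (hp : p ≤ q) (hq : q ≤ j₁ + p) (hr : r + 1 + 2 * p ≤ j₀ + q) (hqr : q ≤ p + r) :
    F₁ (T p q (r + 1)) = T (p + 1) (q + 1) r := by
  obtain ⟨k, rfl⟩ : ∃ k, q = p + k := ⟨q - p, by omega⟩
  rw [A.upper_step H (by omega) (A.ε₁_upper H (by omega)) k (by omega) r (by omega) (by omega),
    Nat.add_right_comm p k 1]

theorem ε₁_stringVertex (A : LocalA2 F₀ F₁ ε₀ φ₀ ε₁ φ₁ M)
    (H : IsHighest ε₀ φ₀ ε₁ φ₁ M j₀ j₁ h) {p q r : ℕ} (hp : p ≤ j₀) (hpq : p ≤ q)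
    (hq : q ≤ j₁ + p) (hr : r + 2 * p ≤ j₀ + q) :
    ε₁ (T p q r) = (p + (q - (p + r)) : ℕ) := by
  obtain ⟨k, rfl⟩ : ∃ k, q = p + k := ⟨q - p, by omega⟩
  rcases Nat.le_total r k with hrk | hkr
  · rw [(A.lower_strings H hp k (by omega) r hrk).1]
    omega
  · rw [A.ε₁_upper H hp k r (by omega) hkr (by omega)]
    omega

end LocalA2

end

/-! ### The operators of `B_l` as piecewise translations of ℤ⁶. -/

namespace Coord

/-- The total map underlying `f₀`. -/
def F₀ (b : Coord) : Coord := b.f₀.getD b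

/-- The total map underlying `f₁`. -/
def F₁ (b : Coord) : Coord := b.f₁.getD b

/-- The total map underlying `e₀`. -/
def E₀ (b : Coord) : Coord := b.e₀.getD b

/-- The total map underlying `e₁`. -/
def E₁ (b : Coord) : Coord := b.e₁.getD b

/-- The element with `z₁, z₂, z₃, z₄ = a, c, d, e` and given `x₁`, `x₂`, `(x̄₃ - x₃) % 2`. -/
def ofZ (x u ρ a c d e : ℤ) : Coord :=
  ⟨x, u, u + d, u + d + 2 * e + ρ, c + (u + d + 2 * e + ρ), a + x⟩

/-- The remainder `ρ` absorbs the halving in `z₄`, so all conditions become linear in integer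
parameters. The operators do not change `ρ`, and it is 0 on `B_l`. -/
theorem exists_ofZ (b : Coord) :
    ∃ x u ρ a c d e : ℤ, (0 ≤ ρ ∧ ρ < 2) ∧ b = ofZ x u ρ a c d e := by
  refine ⟨b.x₁, b.x₂, (b.y₃ - b.x₃) % 2, b.z₁, b.z₂, b.z₃, b.z₄, by omega, ?_⟩
  ext <;> simp only [ofZ, z₁, z₂, z₃, z₄] <;> omega

section

variable {x u ρ a c d e : ℤ}

theorem z₁_ofZ : (ofZ x u ρ a c d e).z₁ = a := by simp only [ofZ, z₁]; omega
theorem z₂_ofZ : (ofZ x u ρ a c d e).z₂ = c := by simp only [ofZ, z₂]; omega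
theorem z₃_ofZ : (ofZ x u ρ a c d e).z₃ = d := by simp only [ofZ, z₃]; omega
theorem z₄_ofZ (hρ : 0 ≤ ρ ∧ ρ < 2) : (ofZ x u ρ a c d e).z₄ = e := by
  simp only [ofZ, z₄]; omega

/-- The six regions cover all integer parameters and exclude each other. Each case records its
region and its translation, which turns later claims into linear arithmetic. -/
theorem F₀_spec (hρ : 0 ≤ ρ ∧ ρ < 2) (x u a c d e : ℤ) :
    (ofZ x u ρ a c d e).f₀ = some (ofZ x u ρ a c d e).F₀ ∧
    ∃ x' u' a' c' d' e', F₀ (ofZ x u ρ a c d e) = ofZ x' u' ρ a' c' d' e' ∧ (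
      ((a + c + d + 3 * e ≤ 0 ∧ a + c + 3 * e ≤ 0 ∧ a + c ≤ 0 ∧ a ≤ 0) ∧
        x + 1 = x' ∧ u = u' ∧ a - 1 = a' ∧ c = c' ∧ d = d' ∧ e = e') ∨
      ((a + c + d + 3 * e ≤ 0 ∧ c + 3 * e ≤ 0 ∧ c ≤ 0 ∧ a > 0) ∧
        x = x' ∧ u = u' ∧ a - 1 = a' ∧ c - 1 = c' ∧ d + 1 = d' ∧ e = e') ∨
      ((a + d + 3 * e ≤ 0 ∧ d + 3 * e ≤ 0 ∧ e ≤ 0 ∧ c > 0 ∧ a + c > 0) ∧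
        x = x' ∧ u = u' ∧ a = a' ∧ c - 1 = c' ∧ d + 2 = d' ∧ e - 1 = e') ∨
      ((a + c + 3 * e > 0 ∧ c + 3 * e > 0 ∧ e > 0 ∧ d ≤ 0 ∧ a + d ≤ 0) ∧
        x = x' ∧ u + 1 = u' ∧ a = a' ∧ c + 2 = c' ∧ d - 1 = d' ∧ e - 1 = e') ∨
      ((a + c + d + 3 * e > 0 ∧ d + 3 * e > 0 ∧ d > 0 ∧ a ≤ 0) ∧
        x + 1 = x' ∧ u = u' ∧ a - 1 = a' ∧ c + 1 = c' ∧ d - 1 = d' ∧ e = e') ∨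
      ((a + c + d + 3 * e > 0 ∧ a + d + 3 * e > 0 ∧ a + d > 0 ∧ a > 0) ∧
        x = x' ∧ u = u' ∧ a - 1 = a' ∧ c = c' ∧ d = d' ∧ e = e')) := by
  have hex : (a + c + d + 3 * e ≤ 0 ∧ a + c + 3 * e ≤ 0 ∧ a + c ≤ 0 ∧ a ≤ 0) ∨
      (a + c + d + 3 * e ≤ 0 ∧ c + 3 * e ≤ 0 ∧ c ≤ 0 ∧ a > 0) ∨
      (a + d + 3 * e ≤ 0 ∧ d + 3 * e ≤ 0 ∧ e ≤ 0 ∧ c > 0 ∧ a + c > 0) ∨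
      (a + c + 3 * e > 0 ∧ c + 3 * e > 0 ∧ e > 0 ∧ d ≤ 0 ∧ a + d ≤ 0) ∨
      (a + c + d + 3 * e > 0 ∧ d + 3 * e > 0 ∧ d > 0 ∧ a ≤ 0) ∨
      (a + c + d + 3 * e > 0 ∧ a + d + 3 * e > 0 ∧ a + d > 0 ∧ a > 0) := by
    omega
  simp only [F₀, f₀, z₁_ofZ, z₂_ofZ, z₃_ofZ, z₄_ofZ hρ]
  rcases hex with h | h | h | h | h | h
  · rw [if_pos h]
    refine ⟨rfl, _, _, _, _, _, _, ?_, Or.inl ⟨h, rfl, rfl, rfl, rfl, rfl, rfl⟩⟩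
    simp only [ofZ, Option.getD_some]; congr 1 <;> ring
  · rw [if_neg (by omega), if_pos h]
    refine ⟨rfl, _, _, _, _, _, _, ?_, Or.inr (Or.inl ⟨h, rfl, rfl, rfl, rfl, rfl, rfl⟩)⟩
    simp only [ofZ, Option.getD_some]; congr 1 <;> ring
  · rw [if_neg (by omega), if_neg (by omega), if_pos h]
    refine ⟨rfl, _, _, _, _, _, _, ?_, Or.inr (Or.inr (Or.inl ⟨h, rfl, rfl, rfl, rfl, rfl, rfl⟩))⟩
    simp only [ofZ, Option.getD_some]; congr 1 <;> ring
  · rw [if_neg (by omega), if_neg (by omega), if_neg (by omega), if_pos h]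
    refine ⟨rfl, _, _, _, _, _, _, ?_,
      Or.inr (Or.inr (Or.inr (Or.inl ⟨h, rfl, rfl, rfl, rfl, rfl, rfl⟩)))⟩
    simp only [ofZ, Option.getD_some]; congr 1 <;> ring
  · rw [if_neg (by omega), if_neg (by omega), if_neg (by omega), if_neg (by omega), if_pos h]
    refine ⟨rfl, _, _, _, _, _, _, ?_,
      Or.inr (Or.inr (Or.inr (Or.inr (Or.inl ⟨h, rfl, rfl, rfl, rfl, rfl, rfl⟩))))⟩
    simp only [ofZ, Option.getD_some]; congr 1 <;> ring
  · rw [if_neg (by omega), if_neg (by omega), if_neg (by omega), if_neg (by omega),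
      if_neg (by omega), if_pos h]
    refine ⟨rfl, _, _, _, _, _, _, ?_,
      Or.inr (Or.inr (Or.inr (Or.inr (Or.inr ⟨h, rfl, rfl, rfl, rfl, rfl, rfl⟩))))⟩
    simp only [ofZ, Option.getD_some]; congr 1 <;> ring

theorem F₁_spec (ρ : ℤ) (x u a c d e : ℤ) :
    (ofZ x u ρ a c d e).f₁ = some (ofZ x u ρ a c d e).F₁ ∧
    ∃ x' u' a' c' d' e', F₁ (ofZ x u ρ a c d e) = ofZ x' u' ρ a' c' d' e' ∧ (
      ((c ≤ -d ∧ d ≤ 0) ∧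
        x - 1 = x' ∧ u + 1 = u' ∧ a + 1 = a' ∧ c = c' ∧ d - 1 = d' ∧ e = e') ∨
      ((c ≤ 0 ∧ 0 < d) ∧
        x = x' ∧ u = u' ∧ a = a' ∧ c - 1 = c' ∧ d - 1 = d' ∧ e + 1 = e') ∨
      ((c > 0 ∧ c > -d) ∧
        x = x' ∧ u = u' ∧ a + 1 = a' ∧ c - 1 = c' ∧ d = d' ∧ e = e')) := by
  have hex : (c ≤ -d ∧ d ≤ 0) ∨
      (c ≤ 0 ∧ 0 < d) ∨
      (c > 0 ∧ c > -d) := by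
    omega
  simp only [F₁, f₁]
  rcases hex with h | h | h
  · rw [if_pos (by simp only [ofZ]; omega)]
    refine ⟨rfl, _, _, _, _, _, _, ?_, Or.inl ⟨h, rfl, rfl, rfl, rfl, rfl, rfl⟩⟩
    simp only [ofZ, Option.getD_some]; congr 1 <;> ring
  · rw [if_neg (by simp only [ofZ]; omega), if_pos (by simp only [ofZ]; omega)]
    refine ⟨rfl, _, _, _, _, _, _, ?_, Or.inr (Or.inl ⟨h, rfl, rfl, rfl, rfl, rfl, rfl⟩)⟩
    simp only [ofZ, Option.getD_some]; congr 1 <;> ring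
  · rw [if_neg (by simp only [ofZ]; omega), if_neg (by simp only [ofZ]; omega),
      if_pos (by simp only [ofZ]; omega)]
    refine ⟨rfl, _, _, _, _, _, _, ?_, Or.inr (Or.inr ⟨h, rfl, rfl, rfl, rfl, rfl, rfl⟩)⟩
    simp only [ofZ, Option.getD_some]; congr 1 <;> ring

theorem E₀_spec (hρ : 0 ≤ ρ ∧ ρ < 2) (x u a c d e : ℤ) :
    (ofZ x u ρ a c d e).e₀ = some (ofZ x u ρ a c d e).E₀ ∧
    ∃ x' u' a' c' d' e', E₀ (ofZ x u ρ a c d e) = ofZ x' u' ρ a' c' d' e' ∧ (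
      ((a + c + d + 3 * e < 0 ∧ a + c + 3 * e < 0 ∧ a + c < 0 ∧ a < 0) ∧
        x - 1 = x' ∧ u = u' ∧ a + 1 = a' ∧ c = c' ∧ d = d' ∧ e = e') ∨
      ((a + c + d + 3 * e < 0 ∧ c + 3 * e < 0 ∧ c < 0 ∧ a ≥ 0) ∧
        x = x' ∧ u = u' ∧ a + 1 = a' ∧ c + 1 = c' ∧ d - 1 = d' ∧ e = e') ∨
      ((a + d + 3 * e < 0 ∧ d + 3 * e < 0 ∧ e < 0 ∧ c ≥ 0 ∧ a + c ≥ 0) ∧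
        x = x' ∧ u = u' ∧ a = a' ∧ c + 1 = c' ∧ d - 2 = d' ∧ e + 1 = e') ∨
      ((a + c + 3 * e ≥ 0 ∧ c + 3 * e ≥ 0 ∧ e ≥ 0 ∧ d < 0 ∧ a + d < 0) ∧
        x = x' ∧ u - 1 = u' ∧ a = a' ∧ c - 2 = c' ∧ d + 1 = d' ∧ e + 1 = e') ∨
      ((a + c + d + 3 * e ≥ 0 ∧ d + 3 * e ≥ 0 ∧ d ≥ 0 ∧ a < 0) ∧
        x - 1 = x' ∧ u = u' ∧ a + 1 = a' ∧ c - 1 = c' ∧ d + 1 = d' ∧ e = e') ∨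
      ((a + c + d + 3 * e ≥ 0 ∧ a + d + 3 * e ≥ 0 ∧ a + d ≥ 0 ∧ a ≥ 0) ∧
        x = x' ∧ u = u' ∧ a + 1 = a' ∧ c = c' ∧ d = d' ∧ e = e')) := by
  have hex : (a + c + d + 3 * e < 0 ∧ a + c + 3 * e < 0 ∧ a + c < 0 ∧ a < 0) ∨
      (a + c + d + 3 * e < 0 ∧ c + 3 * e < 0 ∧ c < 0 ∧ a ≥ 0) ∨
      (a + d + 3 * e < 0 ∧ d + 3 * e < 0 ∧ e < 0 ∧ c ≥ 0 ∧ a + c ≥ 0) ∨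
      (a + c + 3 * e ≥ 0 ∧ c + 3 * e ≥ 0 ∧ e ≥ 0 ∧ d < 0 ∧ a + d < 0) ∨
      (a + c + d + 3 * e ≥ 0 ∧ d + 3 * e ≥ 0 ∧ d ≥ 0 ∧ a < 0) ∨
      (a + c + d + 3 * e ≥ 0 ∧ a + d + 3 * e ≥ 0 ∧ a + d ≥ 0 ∧ a ≥ 0) := by
    omega
  simp only [E₀, e₀, z₁_ofZ, z₂_ofZ, z₃_ofZ, z₄_ofZ hρ]
  rcases hex with h | h | h | h | h | h
  · rw [if_pos h]
    refine ⟨rfl, _, _, _, _, _, _, ?_, Or.inl ⟨h, rfl, rfl, rfl, rfl, rfl, rfl⟩⟩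
    simp only [ofZ, Option.getD_some]; congr 1 <;> ring
  · rw [if_neg (by omega), if_pos h]
    refine ⟨rfl, _, _, _, _, _, _, ?_, Or.inr (Or.inl ⟨h, rfl, rfl, rfl, rfl, rfl, rfl⟩)⟩
    simp only [ofZ, Option.getD_some]; congr 1 <;> ring
  · rw [if_neg (by omega), if_neg (by omega), if_pos h]
    refine ⟨rfl, _, _, _, _, _, _, ?_, Or.inr (Or.inr (Or.inl ⟨h, rfl, rfl, rfl, rfl, rfl, rfl⟩))⟩
    simp only [ofZ, Option.getD_some]; congr 1 <;> ring
  · rw [if_neg (by omega), if_neg (by omega), if_neg (by omega), if_pos h]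
    refine ⟨rfl, _, _, _, _, _, _, ?_,
      Or.inr (Or.inr (Or.inr (Or.inl ⟨h, rfl, rfl, rfl, rfl, rfl, rfl⟩)))⟩
    simp only [ofZ, Option.getD_some]; congr 1 <;> ring
  · rw [if_neg (by omega), if_neg (by omega), if_neg (by omega), if_neg (by omega), if_pos h]
    refine ⟨rfl, _, _, _, _, _, _, ?_,
      Or.inr (Or.inr (Or.inr (Or.inr (Or.inl ⟨h, rfl, rfl, rfl, rfl, rfl, rfl⟩))))⟩
    simp only [ofZ, Option.getD_some]; congr 1 <;> ring
  · rw [if_neg (by omega), if_neg (by omega), if_neg (by omega), if_neg (by omega),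
      if_neg (by omega), if_pos h]
    refine ⟨rfl, _, _, _, _, _, _, ?_,
      Or.inr (Or.inr (Or.inr (Or.inr (Or.inr ⟨h, rfl, rfl, rfl, rfl, rfl, rfl⟩))))⟩
    simp only [ofZ, Option.getD_some]; congr 1 <;> ring

theorem E₁_spec (ρ : ℤ) (x u a c d e : ℤ) :
    (ofZ x u ρ a c d e).e₁ = some (ofZ x u ρ a c d e).E₁ ∧
    ∃ x' u' a' c' d' e', E₁ (ofZ x u ρ a c d e) = ofZ x' u' ρ a' c' d' e' ∧ (
      ((c ≥ -d ∧ c ≥ 0) ∧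
        x = x' ∧ u = u' ∧ a - 1 = a' ∧ c + 1 = c' ∧ d = d' ∧ e = e') ∨
      ((c < 0 ∧ 0 ≤ d) ∧
        x = x' ∧ u = u' ∧ a = a' ∧ c + 1 = c' ∧ d + 1 = d' ∧ e - 1 = e') ∨
      ((c < -d ∧ d < 0) ∧
        x + 1 = x' ∧ u - 1 = u' ∧ a - 1 = a' ∧ c = c' ∧ d + 1 = d' ∧ e = e')) := by
  have hex : (c ≥ -d ∧ c ≥ 0) ∨
      (c < 0 ∧ 0 ≤ d) ∨
      (c < -d ∧ d < 0) := by
    omega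
  simp only [E₁, e₁]
  rcases hex with h | h | h
  · rw [if_pos (by simp only [ofZ]; omega)]
    refine ⟨rfl, _, _, _, _, _, _, ?_, Or.inl ⟨h, rfl, rfl, rfl, rfl, rfl, rfl⟩⟩
    simp only [ofZ, Option.getD_some]; congr 1 <;> ring
  · rw [if_neg (by simp only [ofZ]; omega), if_pos (by simp only [ofZ]; omega)]
    refine ⟨rfl, _, _, _, _, _, _, ?_, Or.inr (Or.inl ⟨h, rfl, rfl, rfl, rfl, rfl, rfl⟩)⟩
    simp only [ofZ, Option.getD_some]; congr 1 <;> ring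
  · rw [if_neg (by simp only [ofZ]; omega), if_neg (by simp only [ofZ]; omega),
      if_pos (by simp only [ofZ]; omega)]
    refine ⟨rfl, _, _, _, _, _, _, ?_, Or.inr (Or.inr ⟨h, rfl, rfl, rfl, rfl, rfl, rfl⟩)⟩
    simp only [ofZ, Option.getD_some]; congr 1 <;> ring

end

/-- The default value in `F₀` is never taken, even outside `B_l`. -/
theorem f₀_eq (b : Coord) : b.f₀ = some b.F₀ := by
  obtain ⟨x, u, ρ, a, c, d, e, hρ, rfl⟩ := b.exists_ofZ
  exact (F₀_spec hρ ..).1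

theorem f₁_eq (b : Coord) : b.f₁ = some b.F₁ := by
  obtain ⟨x, u, ρ, a, c, d, e, hρ, rfl⟩ := b.exists_ofZ
  exact (F₁_spec ..).1

theorem e₀_eq (b : Coord) : b.e₀ = some b.E₀ := by
  obtain ⟨x, u, ρ, a, c, d, e, hρ, rfl⟩ := b.exists_ofZ
  exact (E₀_spec hρ ..).1

theorem e₁_eq (b : Coord) : b.e₁ = some b.E₁ := by
  obtain ⟨x, u, ρ, a, c, d, e, hρ, rfl⟩ := b.exists_ofZ
  exact (E₁_spec ..).1

/-- `φ₀` on `B_l` as a piecewise linear function of the coordinates. -/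
def phi₀ (l : ℤ) (b : Coord) : ℤ :=
  l - b.s + max 0 (max b.z₁ (max (b.z₁ + b.z₂) (max (b.z₁ + b.z₂ + 3 * b.z₄)
    (max (b.z₁ + b.z₂ + b.z₃ + 3 * b.z₄) (2 * b.z₁ + b.z₂ + b.z₃ + 3 * b.z₄)))))

/-- `ε₀` on `B_l` as a piecewise linear function of the coordinates. -/
def eps₀ (l : ℤ) (b : Coord) : ℤ :=
  b.phi₀ l - (2 * b.z₁ + b.z₂ + b.z₃ + 3 * b.z₄)

/-- `φ₁` on `B_l` as a piecewise linear function of the coordinates. -/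
def phi₁ (b : Coord) : ℤ := b.x₁ + max 0 (b.x₃ - b.x₂ + max 0 (b.y₂ - b.y₃))

/-- `ε₁` on `B_l` as a piecewise linear function of the coordinates. -/
def eps₁ (b : Coord) : ℤ := b.y₁ + max 0 (b.y₃ - b.y₂ + max 0 (b.x₂ - b.x₃))

end Coord

/-! ### Verification of the local axioms. -/

namespace Coord

variable {x u ρ a c d e : ℤ}

/-- The value of a sixfold maximum. -/
theorem max₆_spec (a₁ a₂ a₃ a₄ a₅ a₆ : ℤ) :
    ∃ m, max a₁ (max a₂ (max a₃ (max a₄ (max a₅ a₆)))) = m ∧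
      (a₁ ≤ m ∧ a₂ ≤ m ∧ a₃ ≤ m ∧ a₄ ≤ m ∧ a₅ ≤ m ∧ a₆ ≤ m) ∧
      (m = a₁ ∨ m = a₂ ∨ m = a₃ ∨ m = a₄ ∨ m = a₅ ∨ m = a₆) :=
  ⟨_, rfl, by omega, by omega⟩

/-- The maximum is replaced by a variable `m` that bounds all six forms and equals one of them, a
description suited to linear arithmetic. -/
theorem exists_phi₀_ofZ (l : ℤ) (hρ : 0 ≤ ρ ∧ ρ < 2) (x u a c d e : ℤ) : ∃ m,
    (ofZ x u ρ a c d e).phi₀ l = l - (2 * x + 3 * u + a + c + 2 * d + 3 * e + ρ) + m ∧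
    (ofZ x u ρ a c d e).eps₀ l = l - (2 * x + 3 * u + a + c + 2 * d + 3 * e + ρ) + m -
      (2 * a + c + d + 3 * e) ∧
    (0 ≤ m ∧ a ≤ m ∧ a + c ≤ m ∧ a + c + 3 * e ≤ m ∧ a + c + d + 3 * e ≤ m ∧
      2 * a + c + d + 3 * e ≤ m) ∧
    (m = 0 ∨ m = a ∨ m = a + c ∨ m = a + c + 3 * e ∨ m = a + c + d + 3 * e ∨
      m = 2 * a + c + d + 3 * e) := by
  obtain ⟨m, hm, h⟩ := max₆_spec 0 a (a + c) (a + c + 3 * e) (a + c + d + 3 * e)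
    (2 * a + c + d + 3 * e)
  have h₁ : (ofZ x u ρ a c d e).phi₀ l =
      l - (2 * x + 3 * u + a + c + 2 * d + 3 * e + ρ) + m := by
    rw [phi₀, z₁_ofZ, z₂_ofZ, z₃_ofZ, z₄_ofZ hρ, hm]
    simp only [s, ofZ]
    omega
  exact ⟨m, h₁, by rw [eps₀, h₁, z₁_ofZ, z₂_ofZ, z₃_ofZ, z₄_ofZ hρ], h⟩

theorem phi₁_ofZ : (ofZ x u ρ a c d e).phi₁ = x + max 0 (d + max 0 c) := by
  simp only [phi₁, ofZ]; congr 3 <;> ring_nf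

theorem eps₁_ofZ : (ofZ x u ρ a c d e).eps₁ = a + x + max 0 (-c + max 0 (-d)) := by
  simp only [eps₁, ofZ]; congr 3 <;> ring_nf

/-- Every linear form occurring in `(F_k)` drops by exactly one under the `k`-th change, so `(F_k)`
before the step becomes `(E_k)` after it. -/
theorem E₀_F₀ (b : Coord) : b.F₀.E₀ = b := by
  obtain ⟨x, u, ρ, a, c, d, e, hρ, rfl⟩ := b.exists_ofZ
  obtain ⟨-, x₁, u₁, a₁, c₁, d₁, e₁, h₁, k₁⟩ := F₀_spec hρ x u a c d e
  rw [h₁]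
  obtain ⟨-, x₂, u₂, a₂, c₂, d₂, e₂, h₂, k₂⟩ := E₀_spec hρ x₁ u₁ a₁ c₁ d₁ e₁
  rw [h₂]
  congr 1 <;> omega

theorem F₀_E₀ (b : Coord) : b.E₀.F₀ = b := by
  obtain ⟨x, u, ρ, a, c, d, e, hρ, rfl⟩ := b.exists_ofZ
  obtain ⟨-, x₁, u₁, a₁, c₁, d₁, e₁, h₁, k₁⟩ := E₀_spec hρ x u a c d e
  rw [h₁]
  obtain ⟨-, x₂, u₂, a₂, c₂, d₂, e₂, h₂, k₂⟩ := F₀_spec hρ x₁ u₁ a₁ c₁ d₁ e₁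
  rw [h₂]
  congr 1 <;> omega

theorem E₁_F₁ (b : Coord) : b.F₁.E₁ = b := by
  obtain ⟨x, u, ρ, a, c, d, e, hρ, rfl⟩ := b.exists_ofZ
  obtain ⟨-, x₁, u₁, a₁, c₁, d₁, e₁, h₁, k₁⟩ := F₁_spec ρ x u a c d e
  rw [h₁]
  obtain ⟨-, x₂, u₂, a₂, c₂, d₂, e₂, h₂, k₂⟩ := E₁_spec ρ x₁ u₁ a₁ c₁ d₁ e₁
  rw [h₂]
  congr 1 <;> omega

theorem F₁_E₁ (b : Coord) : b.E₁.F₁ = b := by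
  obtain ⟨x, u, ρ, a, c, d, e, hρ, rfl⟩ := b.exists_ofZ
  obtain ⟨-, x₁, u₁, a₁, c₁, d₁, e₁, h₁, k₁⟩ := E₁_spec ρ x u a c d e
  rw [h₁]
  obtain ⟨-, x₂, u₂, a₂, c₂, d₂, e₂, h₂, k₂⟩ := F₁_spec ρ x₁ u₁ a₁ c₁ d₁ e₁
  rw [h₂]
  congr 1 <;> omega

theorem eps₀_F₀ (l : ℤ) (b : Coord) : b.F₀.eps₀ l = b.eps₀ l + 1 := by
  obtain ⟨x, u, ρ, a, c, d, e, hρ, rfl⟩ := b.exists_ofZ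
  obtain ⟨-, x₁, u₁, a₁, c₁, d₁, e₁, h₁, k₁⟩ := F₀_spec hρ x u a c d e
  obtain ⟨m₀, -, p₀, q₀⟩ := exists_phi₀_ofZ l hρ x u a c d e
  obtain ⟨m₁, -, p₁, q₁⟩ := exists_phi₀_ofZ l hρ x₁ u₁ a₁ c₁ d₁ e₁
  rw [h₁, p₀, p₁]
  rcases k₁ with k | k | k | k | k | k <;> omega

theorem eps₁_F₁ (b : Coord) : b.F₁.eps₁ = b.eps₁ + 1 := by
  obtain ⟨x, u, ρ, a, c, d, e, hρ, rfl⟩ := b.exists_ofZ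
  obtain ⟨-, x₁, u₁, a₁, c₁, d₁, e₁, h₁, k₁⟩ := F₁_spec ρ x u a c d e
  rw [h₁, eps₁_ofZ, eps₁_ofZ]
  rcases k₁ with k | k | k <;> omega

theorem wt₀_F₀ (l : ℤ) (b : Coord) :
    b.F₀.phi₀ l - b.F₀.eps₀ l = b.phi₀ l - b.eps₀ l - 2 := by
  obtain ⟨x, u, ρ, a, c, d, e, hρ, rfl⟩ := b.exists_ofZ
  obtain ⟨-, x₁, u₁, a₁, c₁, d₁, e₁, h₁, k₁⟩ := F₀_spec hρ x u a c d e
  simp only [h₁, eps₀, z₁_ofZ, z₂_ofZ, z₃_ofZ, z₄_ofZ hρ]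
  omega

theorem wt₀_F₁ (l : ℤ) (b : Coord) :
    b.F₁.phi₀ l - b.F₁.eps₀ l = b.phi₀ l - b.eps₀ l + 1 := by
  obtain ⟨x, u, ρ, a, c, d, e, hρ, rfl⟩ := b.exists_ofZ
  obtain ⟨-, x₁, u₁, a₁, c₁, d₁, e₁, h₁, k₁⟩ := F₁_spec ρ x u a c d e
  simp only [h₁, eps₀, z₁_ofZ, z₂_ofZ, z₃_ofZ, z₄_ofZ hρ]
  omega

/-- The two maxima in `phi₁` and `eps₁` differ by `z₂ + z₃`, so `φ₁ - ε₁` is the linear form `z₂ +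
z₃ - z₁`. -/
theorem wt₁_F₀ (b : Coord) :
    b.F₀.phi₁ - b.F₀.eps₁ = b.phi₁ - b.eps₁ + 1 := by
  obtain ⟨x, u, ρ, a, c, d, e, hρ, rfl⟩ := b.exists_ofZ
  obtain ⟨-, x₁, u₁, a₁, c₁, d₁, e₁, h₁, k₁⟩ := F₀_spec hρ x u a c d e
  rw [h₁, phi₁_ofZ, eps₁_ofZ, phi₁_ofZ, eps₁_ofZ]
  omega

theorem wt₁_F₁ (b : Coord) :
    b.F₁.phi₁ - b.F₁.eps₁ = b.phi₁ - b.eps₁ - 2 := by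
  obtain ⟨x, u, ρ, a, c, d, e, hρ, rfl⟩ := b.exists_ofZ
  obtain ⟨-, x₁, u₁, a₁, c₁, d₁, e₁, h₁, k₁⟩ := F₁_spec ρ x u a c d e
  rw [h₁, phi₁_ofZ, eps₁_ofZ, phi₁_ofZ, eps₁_ofZ]
  omega

/-- The step `F₀` keeps `ε₁`. -/
def Keep₀ (a c d e : ℤ) : Prop :=
  (a + c + d + 3 * e ≤ 0 ∧ a + c + 3 * e ≤ 0 ∧ a + c ≤ 0 ∧ a ≤ 0) ∨
  (a + c + d + 3 * e ≤ 0 ∧ c + 3 * e ≤ 0 ∧ c ≤ 0 ∧ a > 0 ∧ d ≥ 0) ∨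
  (a + d + 3 * e ≤ 0 ∧ d + 3 * e ≤ 0 ∧ e ≤ 0 ∧ c > 0 ∧ a + c > 0 ∧ c + d ≥ 0) ∨
  (a + c + 3 * e > 0 ∧ c + 3 * e > 0 ∧ e > 0 ∧ d ≤ 0 ∧ a + d ≤ 0 ∧ c + d ≥ 0) ∨
  (a + c + d + 3 * e > 0 ∧ d + 3 * e > 0 ∧ d > 0 ∧ a ≤ 0 ∧ c ≥ 0)

/-- The step `F₁` keeps `ε₀`. -/
def Keep₁ (a c d e : ℤ) : Prop :=
  (c ≤ -d ∧ d ≤ 0 ∧ (a ≥ 0 ∨ a + c ≥ 0 ∨ a + c + 3 * e ≥ 0)) ∨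
  (c ≤ 0 ∧ 0 < d ∧ a + c + d + 3 * e ≥ 0) ∨
  (c > 0 ∧ c > -d ∧ a ≥ 0 ∧ a + d ≥ 0 ∧ a + d + 3 * e ≥ 0)

/-- Region 1 always keeps ε₁ and region 6 always lowers it; in each of the other four one further
inequality decides. -/
theorem eps₁_F₀ (hρ : 0 ≤ ρ ∧ ρ < 2) (x u a c d e : ℤ) :
    (Keep₀ a c d e ∧ (ofZ x u ρ a c d e).F₀.eps₁ = (ofZ x u ρ a c d e).eps₁) ∨
    (¬ Keep₀ a c d e ∧ (ofZ x u ρ a c d e).F₀.eps₁ = (ofZ x u ρ a c d e).eps₁ - 1) := by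
  obtain ⟨-, x', u', a', c', d', e', h, k⟩ := F₀_spec hρ x u a c d e
  rw [h, eps₁_ofZ, eps₁_ofZ, Keep₀]
  rcases k with k | k | k | k | k | k <;> obtain ⟨k, rfl, rfl, rfl, rfl, rfl, rfl⟩ := k
  · exact Or.inl ⟨Or.inl k, by omega⟩
  · rcases le_or_gt 0 d with h | h
    · exact Or.inl ⟨by omega, by omega⟩
    · exact Or.inr ⟨by omega, by omega⟩
  · rcases le_or_gt 0 (c + d) with h | h
    · exact Or.inl ⟨by omega, by omega⟩
    · exact Or.inr ⟨by omega, by omega⟩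
  · rcases le_or_gt 0 (c + d) with h | h
    · exact Or.inl ⟨by omega, by omega⟩
    · exact Or.inr ⟨by omega, by omega⟩
  · rcases le_or_gt 0 c with h | h
    · exact Or.inl ⟨by omega, by omega⟩
    · exact Or.inr ⟨by omega, by omega⟩
  · exact Or.inr ⟨by omega, by omega⟩

theorem eps₀_F₁ (l : ℤ) (hρ : 0 ≤ ρ ∧ ρ < 2) (x u a c d e : ℤ) :
    (Keep₁ a c d e ∧ (ofZ x u ρ a c d e).F₁.eps₀ l = (ofZ x u ρ a c d e).eps₀ l) ∨
    (¬ Keep₁ a c d e ∧ (ofZ x u ρ a c d e).F₁.eps₀ l = (ofZ x u ρ a c d e).eps₀ l - 1) := by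
  obtain ⟨-, x', u', a', c', d', e', h, k⟩ := F₁_spec ρ x u a c d e
  obtain ⟨m, -, p, q⟩ := exists_phi₀_ofZ l hρ x u a c d e
  obtain ⟨m', -, p', q', r'⟩ := exists_phi₀_ofZ l hρ x' u' a' c' d' e'
  rw [h, p, p', Keep₁]
  clear h p p'
  rcases k with k | k | k <;> obtain ⟨k, rfl, rfl, rfl, rfl, rfl, rfl⟩ := k
  · by_cases hk : a ≥ 0 ∨ a + c ≥ 0 ∨ a + c + 3 * e ≥ 0
    · exact Or.inl ⟨by omega, by omega⟩
    · exact Or.inr ⟨by omega, by omega⟩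
  · by_cases hk : a + c + d + 3 * e ≥ 0
    · exact Or.inl ⟨by omega, by omega⟩
    · exact Or.inr ⟨by omega, by omega⟩
  · by_cases hk : a ≥ 0 ∧ a + d ≥ 0 ∧ a + d + 3 * e ≥ 0
    · exact Or.inl ⟨by omega, by omega⟩
    · exact Or.inr ⟨by omega, by omega⟩

end Coord

namespace Coord

theorem eps₁_F₀_le (b : Coord) : b.F₀.eps₁ ≤ b.eps₁ := by
  obtain ⟨x, u, ρ, a, c, d, e, hρ, rfl⟩ := b.exists_ofZ
  rcases eps₁_F₀ hρ x u a c d e with h | h <;> omega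

theorem eps₀_F₁_le (l : ℤ) (b : Coord) : b.F₁.eps₀ l ≤ b.eps₀ l := by
  obtain ⟨x, u, ρ, a, c, d, e, hρ, rfl⟩ := b.exists_ofZ
  rcases eps₀_F₁ l hρ x u a c d e with h | h <;> omega

/-- This merges the region with the extra inequality, so that the case analyses below start from as
few cases as possible. -/
theorem F₀_keep (hρ : 0 ≤ ρ ∧ ρ < 2) (x u a c d e : ℤ) (h : Keep₀ a c d e) :
    ∃ x' u' a' c' d' e', F₀ (ofZ x u ρ a c d e) = ofZ x' u' ρ a' c' d' e' ∧ (
      ((a + c + d + 3 * e ≤ 0 ∧ a + c + 3 * e ≤ 0 ∧ a + c ≤ 0 ∧ a ≤ 0) ∧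
        x + 1 = x' ∧ u = u' ∧ a - 1 = a' ∧ c = c' ∧ d = d' ∧ e = e') ∨
      ((a + c + d + 3 * e ≤ 0 ∧ c + 3 * e ≤ 0 ∧ c ≤ 0 ∧ a > 0 ∧ d ≥ 0) ∧
        x = x' ∧ u = u' ∧ a - 1 = a' ∧ c - 1 = c' ∧ d + 1 = d' ∧ e = e') ∨
      ((a + d + 3 * e ≤ 0 ∧ d + 3 * e ≤ 0 ∧ e ≤ 0 ∧ c > 0 ∧ a + c > 0 ∧ c + d ≥ 0) ∧
        x = x' ∧ u = u' ∧ a = a' ∧ c - 1 = c' ∧ d + 2 = d' ∧ e - 1 = e') ∨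
      ((a + c + 3 * e > 0 ∧ c + 3 * e > 0 ∧ e > 0 ∧ d ≤ 0 ∧ a + d ≤ 0 ∧ c + d ≥ 0) ∧
        x = x' ∧ u + 1 = u' ∧ a = a' ∧ c + 2 = c' ∧ d - 1 = d' ∧ e - 1 = e') ∨
      ((a + c + d + 3 * e > 0 ∧ d + 3 * e > 0 ∧ d > 0 ∧ a ≤ 0 ∧ c ≥ 0) ∧
        x + 1 = x' ∧ u = u' ∧ a - 1 = a' ∧ c + 1 = c' ∧ d - 1 = d' ∧ e = e')) := by
  obtain ⟨-, x', u', a', c', d', e', h', k⟩ := F₀_spec hρ x u a c d e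
  refine ⟨x', u', a', c', d', e', h', ?_⟩
  rw [Keep₀] at h
  rcases k with k | k | k | k | k | k
  · exact Or.inl ⟨by omega, k.2⟩
  · exact Or.inr (Or.inl ⟨by omega, k.2⟩)
  · exact Or.inr (Or.inr (Or.inl ⟨by omega, k.2⟩))
  · exact Or.inr (Or.inr (Or.inr (Or.inl ⟨by omega, k.2⟩)))
  · exact Or.inr (Or.inr (Or.inr (Or.inr (⟨by omega, k.2⟩))))
  · exact absurd h (by omega)

theorem F₀_drop (hρ : 0 ≤ ρ ∧ ρ < 2) (x u a c d e : ℤ) (h : ¬ Keep₀ a c d e) :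
    ∃ x' u' a' c' d' e', F₀ (ofZ x u ρ a c d e) = ofZ x' u' ρ a' c' d' e' ∧ (
      ((a + c + d + 3 * e ≤ 0 ∧ c + 3 * e ≤ 0 ∧ c ≤ 0 ∧ a > 0 ∧ d < 0) ∧
        x = x' ∧ u = u' ∧ a - 1 = a' ∧ c - 1 = c' ∧ d + 1 = d' ∧ e = e') ∨
      ((a + d + 3 * e ≤ 0 ∧ d + 3 * e ≤ 0 ∧ e ≤ 0 ∧ c > 0 ∧ a + c > 0 ∧ c + d < 0) ∧
        x = x' ∧ u = u' ∧ a = a' ∧ c - 1 = c' ∧ d + 2 = d' ∧ e - 1 = e') ∨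
      ((a + c + 3 * e > 0 ∧ c + 3 * e > 0 ∧ e > 0 ∧ d ≤ 0 ∧ a + d ≤ 0 ∧ c + d < 0) ∧
        x = x' ∧ u + 1 = u' ∧ a = a' ∧ c + 2 = c' ∧ d - 1 = d' ∧ e - 1 = e') ∨
      ((a + c + d + 3 * e > 0 ∧ d + 3 * e > 0 ∧ d > 0 ∧ a ≤ 0 ∧ c < 0) ∧
        x + 1 = x' ∧ u = u' ∧ a - 1 = a' ∧ c + 1 = c' ∧ d - 1 = d' ∧ e = e') ∨
      ((a + c + d + 3 * e > 0 ∧ a + d + 3 * e > 0 ∧ a + d > 0 ∧ a > 0) ∧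
        x = x' ∧ u = u' ∧ a - 1 = a' ∧ c = c' ∧ d = d' ∧ e = e')) := by
  obtain ⟨-, x', u', a', c', d', e', h', k⟩ := F₀_spec hρ x u a c d e
  refine ⟨x', u', a', c', d', e', h', ?_⟩
  rw [Keep₀] at h
  rcases k with k | k | k | k | k | k
  · exact absurd h (by omega)
  · exact Or.inl ⟨by omega, k.2⟩
  · exact Or.inr (Or.inl ⟨by omega, k.2⟩)
  · exact Or.inr (Or.inr (Or.inl ⟨by omega, k.2⟩))
  · exact Or.inr (Or.inr (Or.inr (Or.inl ⟨by omega, k.2⟩)))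
  · exact Or.inr (Or.inr (Or.inr (Or.inr (⟨by omega, k.2⟩))))

theorem F₁_keep (ρ : ℤ) (x u a c d e : ℤ) (h : Keep₁ a c d e) :
    ∃ x' u' a' c' d' e', F₁ (ofZ x u ρ a c d e) = ofZ x' u' ρ a' c' d' e' ∧ (
      ((c ≤ -d ∧ d ≤ 0 ∧ a ≥ 0) ∧
        x - 1 = x' ∧ u + 1 = u' ∧ a + 1 = a' ∧ c = c' ∧ d - 1 = d' ∧ e = e') ∨
      ((c ≤ -d ∧ d ≤ 0 ∧ a < 0 ∧ a + c ≥ 0) ∧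
        x - 1 = x' ∧ u + 1 = u' ∧ a + 1 = a' ∧ c = c' ∧ d - 1 = d' ∧ e = e') ∨
      ((c ≤ -d ∧ d ≤ 0 ∧ a < 0 ∧ a + c < 0 ∧ a + c + 3 * e ≥ 0) ∧
        x - 1 = x' ∧ u + 1 = u' ∧ a + 1 = a' ∧ c = c' ∧ d - 1 = d' ∧ e = e') ∨
      ((c ≤ 0 ∧ 0 < d ∧ a + c + d + 3 * e ≥ 0) ∧
        x = x' ∧ u = u' ∧ a = a' ∧ c - 1 = c' ∧ d - 1 = d' ∧ e + 1 = e') ∨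
      ((c > 0 ∧ c > -d ∧ a ≥ 0 ∧ a + d ≥ 0 ∧ a + d + 3 * e ≥ 0) ∧
        x = x' ∧ u = u' ∧ a + 1 = a' ∧ c - 1 = c' ∧ d = d' ∧ e = e')) := by
  obtain ⟨-, x', u', a', c', d', e', h', k⟩ := F₁_spec ρ x u a c d e
  refine ⟨x', u', a', c', d', e', h', ?_⟩
  rw [Keep₁] at h
  rcases k with k | k | k
  · have h : a ≥ 0 ∨ a < 0 ∧ a + c ≥ 0 ∨ a < 0 ∧ a + c < 0 ∧ a + c + 3 * e ≥ 0 := by omega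
    rcases h with h | h | h
    · exact Or.inl ⟨by omega, k.2⟩
    · exact Or.inr (Or.inl ⟨by omega, k.2⟩)
    · exact Or.inr (Or.inr (Or.inl ⟨by omega, k.2⟩))
  · exact Or.inr (Or.inr (Or.inr (Or.inl ⟨by omega, k.2⟩)))
  · exact Or.inr (Or.inr (Or.inr (Or.inr (⟨by omega, k.2⟩))))

theorem F₁_drop (ρ : ℤ) (x u a c d e : ℤ) (h : ¬ Keep₁ a c d e) :
    ∃ x' u' a' c' d' e', F₁ (ofZ x u ρ a c d e) = ofZ x' u' ρ a' c' d' e' ∧ (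
      ((c ≤ -d ∧ d ≤ 0 ∧ a < 0 ∧ a + c < 0 ∧ a + c + 3 * e < 0) ∧
        x - 1 = x' ∧ u + 1 = u' ∧ a + 1 = a' ∧ c = c' ∧ d - 1 = d' ∧ e = e') ∨
      ((c ≤ 0 ∧ 0 < d ∧ a + c + d + 3 * e < 0) ∧
        x = x' ∧ u = u' ∧ a = a' ∧ c - 1 = c' ∧ d - 1 = d' ∧ e + 1 = e') ∨
      ((c > 0 ∧ c > -d ∧ a < 0) ∧
        x = x' ∧ u = u' ∧ a + 1 = a' ∧ c - 1 = c' ∧ d = d' ∧ e = e') ∨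
      ((c > 0 ∧ c > -d ∧ a + d < 0) ∧
        x = x' ∧ u = u' ∧ a + 1 = a' ∧ c - 1 = c' ∧ d = d' ∧ e = e') ∨
      ((c > 0 ∧ c > -d ∧ a + d + 3 * e < 0) ∧
        x = x' ∧ u = u' ∧ a + 1 = a' ∧ c - 1 = c' ∧ d = d' ∧ e = e')) := by
  obtain ⟨-, x', u', a', c', d', e', h', k⟩ := F₁_spec ρ x u a c d e
  refine ⟨x', u', a', c', d', e', h', ?_⟩
  rw [Keep₁] at h
  rcases k with k | k | k
  · exact Or.inl ⟨by omega, k.2⟩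
  · exact Or.inr (Or.inl ⟨by omega, k.2⟩)
  -- Splitting the negated conjunction leaves only conjunctions of inequalities; the overlap of the
  -- three cases is harmless.
  · have h : a < 0 ∨ a + d < 0 ∨ a + d + 3 * e < 0 := by omega
    rcases h with h | h | h
    · exact Or.inr (Or.inr (Or.inl ⟨by omega, k.2⟩))
    · exact Or.inr (Or.inr (Or.inr (Or.inl ⟨by omega, k.2⟩)))
    · exact Or.inr (Or.inr (Or.inr (Or.inr (⟨by omega, k.2⟩))))

/-- In each of the five cases of `Keep₀`, the translated parameters contradict `Keep₁`. -/
theorem drop₀ (l : ℤ) (b : Coord) (h : b.F₀.eps₁ = b.eps₁) :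
    b.F₀.F₁.eps₀ l = b.F₀.eps₀ l - 1 := by
  obtain ⟨x, u, ρ, a, c, d, e, hρ, rfl⟩ := b.exists_ofZ
  have K : Keep₀ a c d e := by
    rcases eps₁_F₀ hρ x u a c d e with h' | h'
    · exact h'.1
    · omega
  clear h
  obtain ⟨x₁, u₁, a₁, c₁, d₁, e₁, h₁, k₁⟩ := F₀_keep hρ x u a c d e K
  rw [h₁]
  clear h₁
  rcases eps₀_F₁ l hρ x₁ u₁ a₁ c₁ d₁ e₁ with h | h
  · exfalso
    have h := h.1
    rw [Keep₁] at h
    clear K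
    rcases k₁ with k₁ | k₁ | k₁ | k₁ | k₁ <;> omega
  · exact h.2

theorem drop₁ (l : ℤ) (b : Coord) (h : b.F₁.eps₀ l = b.eps₀ l) :
    b.F₁.F₀.eps₁ = b.F₁.eps₁ - 1 := by
  obtain ⟨x, u, ρ, a, c, d, e, hρ, rfl⟩ := b.exists_ofZ
  have K : Keep₁ a c d e := by
    rcases eps₀_F₁ l hρ x u a c d e with h' | h'
    · exact h'.1
    · omega
  clear h
  obtain ⟨x₁, u₁, a₁, c₁, d₁, e₁, h₁, k₁⟩ := F₁_keep ρ x u a c d e K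
  rw [h₁]
  clear h₁
  rcases eps₁_F₀ hρ x₁ u₁ a₁ c₁ d₁ e₁ with h | h
  · exfalso
    have h := h.1
    rw [Keep₀] at h
    clear K
    rcases k₁ with k₁ | k₁ | k₁ | k₁ | k₁ <;> omega
  · exact h.2

/-- `F₀_spec` with the image abstracted to `y`, for use after `generalize` in the chases below. -/
theorem F₀_cases (hρ : 0 ≤ ρ ∧ ρ < 2) {y : Coord} (h : (ofZ x u ρ a c d e).F₀ = y) :
    ∃ x' u' a' c' d' e', y = ofZ x' u' ρ a' c' d' e' ∧ (
      ((a + c + d + 3 * e ≤ 0 ∧ a + c + 3 * e ≤ 0 ∧ a + c ≤ 0 ∧ a ≤ 0) ∧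
        x + 1 = x' ∧ u = u' ∧ a - 1 = a' ∧ c = c' ∧ d = d' ∧ e = e') ∨
      ((a + c + d + 3 * e ≤ 0 ∧ c + 3 * e ≤ 0 ∧ c ≤ 0 ∧ a > 0) ∧
        x = x' ∧ u = u' ∧ a - 1 = a' ∧ c - 1 = c' ∧ d + 1 = d' ∧ e = e') ∨
      ((a + d + 3 * e ≤ 0 ∧ d + 3 * e ≤ 0 ∧ e ≤ 0 ∧ c > 0 ∧ a + c > 0) ∧
        x = x' ∧ u = u' ∧ a = a' ∧ c - 1 = c' ∧ d + 2 = d' ∧ e - 1 = e') ∨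
      ((a + c + 3 * e > 0 ∧ c + 3 * e > 0 ∧ e > 0 ∧ d ≤ 0 ∧ a + d ≤ 0) ∧
        x = x' ∧ u + 1 = u' ∧ a = a' ∧ c + 2 = c' ∧ d - 1 = d' ∧ e - 1 = e') ∨
      ((a + c + d + 3 * e > 0 ∧ d + 3 * e > 0 ∧ d > 0 ∧ a ≤ 0) ∧
        x + 1 = x' ∧ u = u' ∧ a - 1 = a' ∧ c + 1 = c' ∧ d - 1 = d' ∧ e = e') ∨
      ((a + c + d + 3 * e > 0 ∧ a + d + 3 * e > 0 ∧ a + d > 0 ∧ a > 0) ∧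
        x = x' ∧ u = u' ∧ a - 1 = a' ∧ c = c' ∧ d = d' ∧ e = e')) :=
  h ▸ (F₀_spec hρ x u a c d e).2

theorem F₁_cases {y : Coord} (h : (ofZ x u ρ a c d e).F₁ = y) :
    ∃ x' u' a' c' d' e', y = ofZ x' u' ρ a' c' d' e' ∧ (
      ((c ≤ -d ∧ d ≤ 0) ∧
        x - 1 = x' ∧ u + 1 = u' ∧ a + 1 = a' ∧ c = c' ∧ d - 1 = d' ∧ e = e') ∨
      ((c ≤ 0 ∧ 0 < d) ∧
        x = x' ∧ u = u' ∧ a = a' ∧ c - 1 = c' ∧ d - 1 = d' ∧ e + 1 = e') ∨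
      ((c > 0 ∧ c > -d) ∧
        x = x' ∧ u = u' ∧ a + 1 = a' ∧ c - 1 = c' ∧ d = d' ∧ e = e')) :=
  h ▸ (F₁_spec ρ x u a c d e).2

/-- A chase through regions: each application splits into its cases, incompatible regions are
discarded at once, and on every surviving branch the two paths have the same total translation. -/
theorem square₀ (b : Coord) (h : b.F₀.eps₁ = b.eps₁ - 1) : b.F₁.F₀ = b.F₀.F₁ := by
  obtain ⟨x, u, ρ, a, c, d, e, hρ, rfl⟩ := b.exists_ofZ
  have K : ¬ Keep₀ a c d e := by
    rcases eps₁_F₀ hρ x u a c d e with h' | h'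
    · omega
    · exact h'.1
  clear h
  obtain ⟨x₁, u₁, a₁, c₁, d₁, e₁, h₁, k₁⟩ := F₀_drop hρ x u a c d e K
  rw [h₁]
  clear h₁
  clear K
  rcases k₁ with k₁ | k₁ | k₁ | k₁ | k₁ <;> obtain ⟨k₁, rfl, rfl, rfl, rfl, rfl, rfl⟩ := k₁
  all_goals
    generalize hy : (ofZ _ _ _ _ _ _ _).F₁ = y
    obtain ⟨_, _, _, _, _, _, rfl, k⟩ := F₁_cases hy
    clear hy
    rcases k with k | k | k <;> obtain ⟨k, rfl, rfl, rfl, rfl, rfl, rfl⟩ := k <;>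
      try (exfalso; omega)
  all_goals
    generalize hy : (ofZ _ _ _ _ _ _ _).F₀ = y
    obtain ⟨_, _, _, _, _, _, rfl, k⟩ := F₀_cases hρ hy
    clear hy
    rcases k with k | k | k | k | k | k <;> obtain ⟨k, rfl, rfl, rfl, rfl, rfl, rfl⟩ := k <;>
      try (exfalso; omega)
  all_goals
    generalize hy : (ofZ _ _ _ _ _ _ _).F₁ = y
    obtain ⟨_, _, _, _, _, _, rfl, k⟩ := F₁_cases hy
    clear hy
    rcases k with k | k | k <;> obtain ⟨k, rfl, rfl, rfl, rfl, rfl, rfl⟩ := k <;>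
      try (exfalso; omega)
  all_goals (congr 1 <;> ring)

theorem square₁ (l : ℤ) (b : Coord) (h : b.F₁.eps₀ l = b.eps₀ l - 1) : b.F₁.F₀ = b.F₀.F₁ := by
  obtain ⟨x, u, ρ, a, c, d, e, hρ, rfl⟩ := b.exists_ofZ
  have K : ¬ Keep₁ a c d e := by
    rcases eps₀_F₁ l hρ x u a c d e with h' | h'
    · omega
    · exact h'.1
  clear h
  obtain ⟨x₃, u₃, a₃, c₃, d₃, e₃, h₃, k₃⟩ := F₁_drop ρ x u a c d e K
  rw [h₃]
  clear h₃
  clear K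
  rcases k₃ with k₃ | k₃ | k₃ | k₃ | k₃ <;> obtain ⟨k₃, rfl, rfl, rfl, rfl, rfl, rfl⟩ := k₃
  all_goals
    generalize hy : (ofZ _ _ _ _ _ _ _).F₀ = y
    obtain ⟨_, _, _, _, _, _, rfl, k⟩ := F₀_cases hρ hy
    clear hy
    rcases k with k | k | k | k | k | k <;> obtain ⟨k, rfl, rfl, rfl, rfl, rfl, rfl⟩ := k <;>
      try (exfalso; omega)
  all_goals
    generalize hy : (ofZ _ _ _ _ _ _ _).F₀ = y
    obtain ⟨_, _, _, _, _, _, rfl, k⟩ := F₀_cases hρ hy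
    clear hy
    rcases k with k | k | k | k | k | k <;> obtain ⟨k, rfl, rfl, rfl, rfl, rfl, rfl⟩ := k <;>
      try (exfalso; omega)
  all_goals
    generalize hy : (ofZ _ _ _ _ _ _ _).F₁ = y
    obtain ⟨_, _, _, _, _, _, rfl, k⟩ := F₁_cases hy
    clear hy
    rcases k with k | k | k <;> obtain ⟨k, rfl, rfl, rfl, rfl, rfl, rfl⟩ := k <;>
      try (exfalso; omega)
  all_goals (congr 1 <;> ring)

-- The chase of `square₀`, along two paths of length four. The first step of each is restricted by
-- `Keep₀` or `Keep₁`, and incompatible pairs are removed before the other six steps are expanded.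
set_option maxHeartbeats 1000000 in
theorem octagon (l : ℤ) (b : Coord) (h₀ : b.F₀.eps₁ = b.eps₁) (h₁ : b.F₁.eps₀ l = b.eps₀ l) :
    b.F₀.F₁.F₁.F₀ = b.F₁.F₀.F₀.F₁ := by
  obtain ⟨x, u, ρ, a, c, d, e, hρ, rfl⟩ := b.exists_ofZ
  have K₀ : Keep₀ a c d e := by
    rcases eps₁_F₀ hρ x u a c d e with h' | h'
    · exact h'.1
    · omega
  have K₁ : Keep₁ a c d e := by
    rcases eps₀_F₁ l hρ x u a c d e with h' | h'
    · exact h'.1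
    · omega
  clear h₀ h₁
  obtain ⟨x₁, u₁, a₁, c₁, d₁, e₁, h₁, k₁⟩ := F₀_keep hρ x u a c d e K₀
  obtain ⟨x₅, u₅, a₅, c₅, d₅, e₅, h₅, k₅⟩ := F₁_keep ρ x u a c d e K₁
  rw [h₁]
  clear h₁
  rw [h₅]
  clear h₅
  clear K₀ K₁
  rcases k₁ with k₁ | k₁ | k₁ | k₁ | k₁ <;> obtain ⟨k₁, rfl, rfl, rfl, rfl, rfl, rfl⟩ := k₁ <;>
  rcases k₅ with k₅ | k₅ | k₅ | k₅ | k₅ <;> obtain ⟨k₅, rfl, rfl, rfl, rfl, rfl, rfl⟩ := k₅ <;>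
  try (exfalso; omega)
  all_goals
    generalize hy : (ofZ _ _ _ _ _ _ _).F₁ = y
    obtain ⟨_, _, _, _, _, _, rfl, k⟩ := F₁_cases hy
    clear hy
    rcases k with k | k | k <;> obtain ⟨k, rfl, rfl, rfl, rfl, rfl, rfl⟩ := k <;>
      try (exfalso; omega)
  all_goals
    generalize hy : (ofZ _ _ _ _ _ _ _).F₀ = y
    obtain ⟨_, _, _, _, _, _, rfl, k⟩ := F₀_cases hρ hy
    clear hy
    rcases k with k | k | k | k | k | k <;> obtain ⟨k, rfl, rfl, rfl, rfl, rfl, rfl⟩ := k <;>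
      try (exfalso; omega)
  all_goals
    generalize hy : (ofZ _ _ _ _ _ _ _).F₀ = y
    obtain ⟨_, _, _, _, _, _, rfl, k⟩ := F₀_cases hρ hy
    clear hy
    rcases k with k | k | k | k | k | k <;> obtain ⟨k, rfl, rfl, rfl, rfl, rfl, rfl⟩ := k <;>
      try (exfalso; omega)
  all_goals
    generalize hy : (ofZ _ _ _ _ _ _ _).F₁ = y
    obtain ⟨_, _, _, _, _, _, rfl, k⟩ := F₁_cases hy
    clear hy
    rcases k with k | k | k <;> obtain ⟨k, rfl, rfl, rfl, rfl, rfl, rfl⟩ := k <;>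
      try (exfalso; omega)
  all_goals
    generalize hy : (ofZ _ _ _ _ _ _ _).F₀ = y
    obtain ⟨_, _, _, _, _, _, rfl, k⟩ := F₀_cases hρ hy
    clear hy
    rcases k with k | k | k | k | k | k <;> obtain ⟨k, rfl, rfl, rfl, rfl, rfl, rfl⟩ := k <;>
      try (exfalso; omega)
  all_goals
    generalize hy : (ofZ _ _ _ _ _ _ _).F₁ = y
    obtain ⟨_, _, _, _, _, _, rfl, k⟩ := F₁_cases hy
    clear hy
    rcases k with k | k | k <;> obtain ⟨k, rfl, rfl, rfl, rfl, rfl, rfl⟩ := k <;>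
      try (exfalso; omega)
  all_goals (congr 1 <;> ring)

end Coord

/-! ### Membership in `B_l` and its highest weight vertices. -/

namespace Coord

variable {x u ρ a c d e : ℤ}

theorem mem_ofZ (l : ℕ) (hρ : 0 ≤ ρ ∧ ρ < 2) : (ofZ x u ρ a c d e).Mem l ↔
    ρ = 0 ∧ 0 ≤ x ∧ 0 ≤ u ∧ 0 ≤ u + d ∧ 0 ≤ u + d + 2 * e ∧ 0 ≤ c + u + d + 2 * e ∧ 0 ≤ a + x ∧
      2 * x + 3 * u + a + c + 2 * d + 3 * e ≤ l := by
  simp only [Mem, s, ofZ]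
  omega

theorem Mem.phi₀_nonneg {l : ℕ} {b : Coord} (h : b.Mem l) : 0 ≤ b.phi₀ l := by
  have := h.2.2
  simp only [phi₀]
  omega

theorem Mem.eps₀_nonneg {l : ℕ} {b : Coord} (h : b.Mem l) : 0 ≤ b.eps₀ l := by
  have := h.2.2
  simp only [eps₀, phi₀]
  omega

theorem Mem.phi₁_nonneg {l : ℕ} {b : Coord} (h : b.Mem l) : 0 ≤ b.phi₁ := by
  have := h.1.1
  simp only [phi₁]
  omega

theorem Mem.eps₁_nonneg {l : ℕ} {b : Coord} (h : b.Mem l) : 0 ≤ b.eps₁ := by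
  have := h.1.2.2.2.2.2
  simp only [eps₁]
  omega

/-- Only region 1 raises `s`, and there `m = 0`, so `φ₀ = l - s` measures the room left. In the
other regions the inequalities make the lowered coordinates large enough. -/
theorem Mem.F₀ {l : ℕ} {b : Coord} (h : b.Mem l) (hp : 0 < b.phi₀ l) : b.F₀.Mem l := by
  obtain ⟨x, u, ρ, a, c, d, e, hρ, rfl⟩ := b.exists_ofZ
  obtain ⟨-, x', u', a', c', d', e', h', k⟩ := F₀_spec hρ x u a c d e
  obtain ⟨m, p, -, q, r⟩ := exists_phi₀_ofZ l hρ x u a c d e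
  rw [p] at hp
  rw [mem_ofZ l hρ] at h
  rw [h', mem_ofZ l hρ]
  clear h' p
  rcases k with k | k | k | k | k | k <;> omega

theorem Mem.E₀ {l : ℕ} {b : Coord} (h : b.Mem l) (hp : 0 < b.eps₀ l) : b.E₀.Mem l := by
  obtain ⟨x, u, ρ, a, c, d, e, hρ, rfl⟩ := b.exists_ofZ
  obtain ⟨-, x', u', a', c', d', e', h', k⟩ := E₀_spec hρ x u a c d e
  obtain ⟨m, -, p, q, r⟩ := exists_phi₀_ofZ l hρ x u a c d e
  rw [p] at hp
  rw [mem_ofZ l hρ] at h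
  rw [h', mem_ofZ l hρ]
  clear h' p
  rcases k with k | k | k | k | k | k <;> omega

theorem Mem.F₁ {l : ℕ} {b : Coord} (h : b.Mem l) (hp : 0 < b.phi₁) : b.F₁.Mem l := by
  obtain ⟨x, u, ρ, a, c, d, e, hρ, rfl⟩ := b.exists_ofZ
  obtain ⟨-, x', u', a', c', d', e', h', k⟩ := F₁_spec ρ x u a c d e
  rw [phi₁_ofZ] at hp
  rw [mem_ofZ l hρ] at h
  rw [h', mem_ofZ l hρ]
  clear h'
  rcases k with k | k | k <;> omega

theorem Mem.E₁ {l : ℕ} {b : Coord} (h : b.Mem l) (hp : 0 < b.eps₁) : b.E₁.Mem l := by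
  obtain ⟨x, u, ρ, a, c, d, e, hρ, rfl⟩ := b.exists_ofZ
  obtain ⟨-, x', u', a', c', d', e', h', k⟩ := E₁_spec ρ x u a c d e
  rw [eps₁_ofZ] at hp
  rw [mem_ofZ l hρ] at h
  rw [h', mem_ofZ l hρ]
  clear h'
  rcases k with k | k | k <;> omega

theorem phi₀_F₀ (l : ℤ) (b : Coord) : b.F₀.phi₀ l = b.phi₀ l - 1 := by
  have h₁ := wt₀_F₀ l b
  have h₂ := eps₀_F₀ l b
  omega

theorem phi₁_F₁ (b : Coord) : b.F₁.phi₁ = b.phi₁ - 1 := by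
  have h₁ := wt₁_F₁ b
  have h₂ := eps₁_F₁ b
  omega

theorem eps₀_E₀ (l : ℤ) (b : Coord) : b.E₀.eps₀ l = b.eps₀ l - 1 := by
  have h := eps₀_F₀ l b.E₀
  rw [F₀_E₀] at h
  omega

theorem eps₁_E₁ (b : Coord) : b.E₁.eps₁ = b.eps₁ - 1 := by
  have h := eps₁_F₁ b.E₁
  rw [F₁_E₁] at h
  omega

theorem Mem.F₀_iff {l : ℕ} {b : Coord} (h : b.Mem l) : b.F₀.Mem l ↔ 0 < b.phi₀ l := by
  refine ⟨fun h' => ?_, h.F₀⟩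
  have h₁ := h'.phi₀_nonneg
  have h₂ := phi₀_F₀ l b
  omega

theorem Mem.F₁_iff {l : ℕ} {b : Coord} (h : b.Mem l) : b.F₁.Mem l ↔ 0 < b.phi₁ := by
  refine ⟨fun h' => ?_, h.F₁⟩
  have h₁ := h'.phi₁_nonneg
  have h₂ := phi₁_F₁ b
  omega

theorem Mem.E₀_iff {l : ℕ} {b : Coord} (h : b.Mem l) : b.E₀.Mem l ↔ 0 < b.eps₀ l := by
  refine ⟨fun h' => ?_, h.E₀⟩
  have h₁ := h'.eps₀_nonneg
  have h₂ := eps₀_E₀ l b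
  omega

theorem Mem.E₁_iff {l : ℕ} {b : Coord} (h : b.Mem l) : b.E₁.Mem l ↔ 0 < b.eps₁ := by
  refine ⟨fun h' => ?_, h.E₁⟩
  have h₁ := h'.eps₁_nonneg
  have h₂ := eps₁_E₁ b
  omega

/-- The maps `F₀`, `F₁` on coordinates satisfy the local axioms of type `A₂`. -/
theorem localA2 (l : ℕ) :
    LocalA2 F₀ F₁ (eps₀ l) (phi₀ l) eps₁ phi₁ (Mem l) where
  inj₀ := Function.LeftInverse.injective E₀_F₀
  inj₁ := Function.LeftInverse.injective E₁_F₁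
  ε₀_nonneg _ h := h.eps₀_nonneg
  ε₁_nonneg _ h := h.eps₁_nonneg
  mem_F₀ _ h := h.F₀_iff
  mem_F₁ _ h := h.F₁_iff
  ε₀_F₀ := eps₀_F₀ l
  ε₁_F₁ := eps₁_F₁
  wt₀_F₀ := wt₀_F₀ l
  wt₀_F₁ := wt₀_F₁ l
  wt₁_F₀ := wt₁_F₀
  wt₁_F₁ := wt₁_F₁
  ε₀_F₁_le := eps₀_F₁_le l
  ε₁_F₀_le := eps₁_F₀_le
  drop₀ x h := by rw [drop₀ l x h, eps₀_F₀]; ring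
  drop₁ x h := by rw [drop₁ l x h, eps₁_F₁]; ring
  square₀ x h := square₀ x h
  square₁ x h := square₁ l x h
  octagon x h h' := octagon l x h h'

/-- `b̄` is a highest weight vertex of weight `j₀Λ₀ + j₁Λ₁`. -/
theorem isHighest_bBar {l : ℕ} (D : DecompIndex l) :
    IsHighest (eps₀ l) (phi₀ l) eps₁ phi₁ (Mem l) D.j₀ D.j₁ (bBarCoord l D.i D.j₀ D.j₁) := by
  have hm := bBarCoord_mem D
  obtain ⟨i, j₀, j₁, h1, h2, h3, h4, h5, h6, h7⟩ := D
  simp only [Nat.ModEq] at h6 h7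
  obtain ⟨Y₀, hY₀⟩ : ∃ Y₀ : ℤ, (l : ℤ) - i - j₀ = 3 * Y₀ := ⟨((l : ℤ) - i - j₀) / 3, by omega⟩
  obtain ⟨Y₁, hY₁⟩ : ∃ Y₁ : ℤ, (l : ℤ) - i - j₁ = 3 * Y₁ := ⟨((l : ℤ) - i - j₁) / 3, by omega⟩
  simp only [bBarCoord, hY₀, hY₁] at hm ⊢
  have e₀ : 3 * Y₀ / 3 = Y₀ := by omega
  have e₁ : 3 * Y₁ / 3 = Y₁ := by omega
  rw [e₀, e₁] at hm ⊢
  refine ⟨hm, ?_, ?_, ?_, ?_⟩ <;> split_ifs <;>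
    simp only [eps₀, phi₀, eps₁, phi₁, s, z₁, z₂, z₃, z₄] <;> omega

/-- Every highest weight vertex of `B_l` is one of the elements `b̄`. -/
theorem Mem.exists_eq_bBar {l : ℕ} {b : Coord} (h : b.Mem l) (h₀ : b.eps₀ l = 0)
    (h₁ : b.eps₁ = 0) : ∃ D : DecompIndex l, b = bBarCoord l D.i D.j₀ D.j₁ := by
  obtain ⟨x, u, ρ, a, c, d, e, hρ, rfl⟩ := b.exists_ofZ
  obtain ⟨m, -, p, q, -⟩ := exists_phi₀_ofZ l hρ x u a c d e
  rw [p] at h₀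
  rw [eps₁_ofZ] at h₁
  rw [mem_ofZ l hρ] at h
  -- `eps₀` is a sum of `l - s` and `m - (2a + c + d + 3e)`, both nonnegative, so both vanish.
  -- Comparing `m` with `a + c + d + 3e` gives `a ≥ 0`, while `eps₁ = 0` gives `a + x = 0` with `x ≥
  -- 0`.
  obtain ⟨rfl, rfl, rfl⟩ : ρ = 0 ∧ x = 0 ∧ a = 0 := by omega
  have hc : 0 ≤ c ∧ 0 ≤ d ∧ 0 ≤ d + 3 * e := by omega
  have hl : (l : ℤ) = 3 * u + c + 2 * d + 3 * e := by omega
  rcases le_or_gt e 0 with he | he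
  -- Here `j₀` and `j₁` are the weights at `a = 0`, `i` is the smaller of `d` and `d + 3e`, and the
  -- sign of `e` selects the branch of `b̄`.
  · refine ⟨⟨(d + 3 * e).toNat, (c + d + 3 * e).toNat, (c + d).toNat, by omega, by omega,
      by omega, by omega, by omega, ?_, ?_⟩, ?_⟩
    · rw [Nat.ModEq]; omega
    · rw [Nat.ModEq]; omega
    · dsimp only
      rw [bBarCoord, if_pos (by omega)]
      ext <;> simp only [ofZ] <;> omega
  · refine ⟨⟨d.toNat, (c + d + 3 * e).toNat, (c + d).toNat, by omega, by omega,
      by omega, by omega, by omega, ?_, ?_⟩, ?_⟩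
    · rw [Nat.ModEq]; omega
    · rw [Nat.ModEq]; omega
    · dsimp only
      rw [bBarCoord, if_neg (by omega)]
      ext <;> simp only [ofZ] <;> omega

theorem bBarCoord_injective {l : ℕ} {D D' : DecompIndex l}
    (h : bBarCoord l D.i D.j₀ D.j₁ = bBarCoord l D'.i D'.j₀ D'.j₁) : D = D' := by
  have H := isHighest_bBar D
  have H' := isHighest_bBar D'
  have e₀ : D.j₀ = D'.j₀ := by
    have := H.φ₀_eq
    rw [h, H'.φ₀_eq] at this
    exact_mod_cast this.symm
  have e₁ : D.j₁ = D'.j₁ := by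
    have := H.φ₁_eq
    rw [h, H'.φ₁_eq] at this
    exact_mod_cast this.symm
  obtain ⟨i, j₀, j₁, h1, h2, h3, h4, h5, h6, h7⟩ := D
  obtain ⟨i', j₀', j₁', h1', h2', h3', h4', h5', h6', h7'⟩ := D'
  obtain rfl : j₀ = j₀' := e₀
  obtain rfl : j₁ = j₁' := e₁
  simp only [Nat.ModEq] at h6 h7 h6' h7'
  -- In both branches `x₂` is `(l - i - max j₀ j₁) / 3`, an exact quotient, so it determines `i`.
  have hi : i = i' := by
    simp only [bBarCoord] at h
    split_ifs at h <;> simp only [Coord.mk.injEq] at h <;> omega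
  subst hi
  rfl

end Coord

/-! ### Tableaux as coordinates of vertices. -/

section

variable {X : Type} {F₀ F₁ : X → X} {ε₀ φ₀ ε₁ φ₁ : X → ℤ} {M : X → Prop} {j₀ j₁ : ℕ} {h : X}

theorem LocalA2.mem_tab (A : LocalA2 F₀ F₁ ε₀ φ₀ ε₁ φ₁ M)
    (H : IsHighest ε₀ φ₀ ε₁ φ₁ M j₀ j₁ h) (t : TabA2 j₀ j₁) :
    M (stringVertex F₀ F₁ h t.p t.q t.r) := by
  obtain ⟨p, q, r, h1, h2, h3, h4⟩ := t
  obtain ⟨k, rfl⟩ : ∃ k, q = p + k := ⟨q - p, by omega⟩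
  exact A.mem_stringVertex H h1 (by omega) (by dsimp only; omega)

theorem LocalA2.ε₀_tab (A : LocalA2 F₀ F₁ ε₀ φ₀ ε₁ φ₁ M)
    (H : IsHighest ε₀ φ₀ ε₁ φ₁ M j₀ j₁ h) (t : TabA2 j₀ j₁) :
    ε₀ (stringVertex F₀ F₁ h t.p t.q t.r) = t.r := by
  obtain ⟨p, q, r, h1, h2, h3, h4⟩ := t
  obtain ⟨k, rfl⟩ : ∃ k, q = p + k := ⟨q - p, by omega⟩
  exact A.ε₀_stringVertex H h1 (by omega) r

theorem LocalA2.φ₀_tab (A : LocalA2 F₀ F₁ ε₀ φ₀ ε₁ φ₁ M)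
    (H : IsHighest ε₀ φ₀ ε₁ φ₁ M j₀ j₁ h) (t : TabA2 j₀ j₁) :
    φ₀ (stringVertex F₀ F₁ h t.p t.q t.r) = (j₀ + t.q - (2 * t.p + t.r) : ℕ) := by
  have h1 := A.ε₀_tab H t
  have h2 := A.wt₀_stringVertex H t.p t.q t.r
  have h3 := t.r_le
  omega

theorem LocalA2.ε₁_tab (A : LocalA2 F₀ F₁ ε₀ φ₀ ε₁ φ₁ M)
    (H : IsHighest ε₀ φ₀ ε₁ φ₁ M j₀ j₁ h) (t : TabA2 j₀ j₁) :
    ε₁ (stringVertex F₀ F₁ h t.p t.q t.r) = (t.p + (t.q - (t.p + t.r)) : ℕ) :=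
  A.ε₁_stringVertex H t.p_le t.p_le_q t.q_le t.r_le

theorem LocalA2.φ₁_tab (A : LocalA2 F₀ F₁ ε₀ φ₀ ε₁ φ₁ M)
    (H : IsHighest ε₀ φ₀ ε₁ φ₁ M j₀ j₁ h) (t : TabA2 j₀ j₁) :
    φ₁ (stringVertex F₀ F₁ h t.p t.q t.r) =
      ((t.p + t.r - t.q) + (j₁ + t.p - t.q) : ℕ) := by
  have h1 := A.ε₁_tab H t
  have h2 := A.wt₁_stringVertex H t.p t.q t.r
  have h3 := t.q_le
  omega

/-- A vertex `F₀^r F₁^q F₀^p h` determines the tableau `t(p, q, r)` and the highest weight vertex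
`h`. -/
theorem LocalA2.tab_unique (A : LocalA2 F₀ F₁ ε₀ φ₀ ε₁ φ₁ M)
    (H : IsHighest ε₀ φ₀ ε₁ φ₁ M j₀ j₁ h) (t : TabA2 j₀ j₁) {j₀' j₁' : ℕ} {h' : X}
    (H' : IsHighest ε₀ φ₀ ε₁ φ₁ M j₀' j₁' h') (t' : TabA2 j₀' j₁')
    (e : stringVertex F₀ F₁ h t.p t.q t.r = stringVertex F₀ F₁ h' t'.p t'.q t'.r) :
    (t.p = t'.p ∧ t.q = t'.q ∧ t.r = t'.r) ∧ h = h' := by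
  -- ε₀ reads off `r`; after cancelling `F₀^r`, ε₁ reads off `q`; after cancelling `F₁^q`, ε₀ reads
  -- off `p`.
  have hr : t.r = t'.r := by
    have h1 := A.ε₀_tab H t
    rw [e, A.ε₀_tab H' t'] at h1
    exact_mod_cast h1.symm
  rw [stringVertex, stringVertex, hr] at e
  have e := A.inj₀.iterate _ e
  have hq : t.q = t'.q := by
    have h1 := A.ε₁_iterate t.q (F₀^[t.p] h)
    rw [e, A.ε₁_iterate, A.ε₁_first H t.p_le, A.ε₁_first H' t'.p_le] at h1
    omega
  rw [hq] at e
  have e := A.inj₁.iterate _ e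
  have hp : t.p = t'.p := by
    have h1 := A.ε₀_iterate t.p h
    rw [e, A.ε₀_iterate, H.ε₀_eq, H'.ε₀_eq] at h1
    omega
  rw [hp] at e
  exact ⟨⟨hp, hq, hr⟩, A.inj₀.iterate _ e⟩

end

/-! ### String lengths -/

theorem iterOp_succ {B : Type} (op : B → Option B) (k : ℕ) (b : B) :
    iterOp op (k + 1) b = (op b).bind (iterOp op k) := by
  rw [iterOp, Function.iterate_succ_apply]
  cases h : op b with
  | none =>
    simp only [Option.bind_some, h, Option.bind_none]
    exact Function.iterate_fixed rfl k
  | some b' => simp only [Option.bind_some, h]; rfl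

/-- The supremum is taken over `{k | k ≤ n b}`, since `n` counts down by one along `op` until the
operator gives 0. -/
theorem stringLength_eq {B : Type} {op : B → Option B} (n : B → ℕ)
    (h₀ : ∀ b, n b = 0 → op b = none)
    (h₁ : ∀ b, n b ≠ 0 → ∃ b', op b = some b' ∧ n b' + 1 = n b) (b : B) :
    stringLength op b = n b := by
  have key : ∀ k b, iterOp op k b ≠ none ↔ k ≤ n b := by
    intro k
    induction k with
    | zero => intro b; simp [iterOp]
    | succ k ih =>
      intro b
      rw [iterOp_succ]
      by_cases hb : n b = 0
      · rw [h₀ b hb, hb]; simp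
      · obtain ⟨b', e, hb'⟩ := h₁ b hb
        rw [e, Option.bind_some, ih]
        omega
  have : {k : ℕ | iterOp op k b ≠ none} = Set.Iic (n b) := by
    ext k; exact key k b
  rw [stringLength, this]
  exact csSup_Iic

/-! ### The operators of `B_l` -/

theorem toBSet_of_mem {l : ℕ} {b : Coord} (h : b.Mem l) : toBSet l b = some ⟨b, h⟩ := dif_pos h

theorem toBSet_of_not_mem {l : ℕ} {b : Coord} (h : ¬ b.Mem l) : toBSet l b = none := dif_neg h

theorem toBSet_eq_some {l : ℕ} {b : Coord} {b' : BSet l} (h : toBSet l b = some b') :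
    b = b'.1 := by
  by_cases hb : b.Mem l
  · rw [toBSet_of_mem hb] at h
    exact congrArg Subtype.val (Option.some.inj h)
  · rw [toBSet_of_not_mem hb] at h
    cases h

namespace crystalB01

variable {l : ℕ}

theorem e_zero (b : BSet l) : (crystalB01 l).e 0 b = toBSet l b.1.E₀ := by
  change b.1.e₀.bind (toBSet l) = _
  rw [Coord.e₀_eq, Option.bind_some]

theorem e_one (b : BSet l) : (crystalB01 l).e 1 b = toBSet l b.1.E₁ := by
  change b.1.e₁.bind (toBSet l) = _
  rw [Coord.e₁_eq, Option.bind_some]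

theorem f_zero (b : BSet l) : (crystalB01 l).f 0 b = toBSet l b.1.F₀ := by
  change b.1.f₀.bind (toBSet l) = _
  rw [Coord.f₀_eq, Option.bind_some]

theorem f_one (b : BSet l) : (crystalB01 l).f 1 b = toBSet l b.1.F₁ := by
  change b.1.f₁.bind (toBSet l) = _
  rw [Coord.f₁_eq, Option.bind_some]

theorem ε_zero (b : BSet l) : (crystalB01 l).ε 0 b = (b.1.eps₀ l).toNat := by
  change stringLength ((crystalB01 l).e 0) b = _
  refine stringLength_eq (fun b : BSet l => (b.1.eps₀ l).toNat) (fun b hb => ?_)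
    (fun b hb => ?_) b
  · rw [e_zero, toBSet_of_not_mem]
    rw [b.2.E₀_iff]
    omega
  · have h : b.1.E₀.Mem l := b.2.E₀ (by omega)
    refine ⟨⟨_, h⟩, by rw [e_zero, toBSet_of_mem h], ?_⟩
    have := Coord.eps₀_E₀ l b.1
    dsimp only
    omega

theorem ε_one (b : BSet l) : (crystalB01 l).ε 1 b = b.1.eps₁.toNat := by
  change stringLength ((crystalB01 l).e 1) b = _
  refine stringLength_eq (fun b : BSet l => b.1.eps₁.toNat) (fun b hb => ?_)
    (fun b hb => ?_) b
  · rw [e_one, toBSet_of_not_mem]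
    rw [b.2.E₁_iff]
    omega
  · have h : b.1.E₁.Mem l := b.2.E₁ (by omega)
    refine ⟨⟨_, h⟩, by rw [e_one, toBSet_of_mem h], ?_⟩
    have := Coord.eps₁_E₁ b.1
    dsimp only
    omega

theorem φ_zero (b : BSet l) : (crystalB01 l).φ 0 b = (b.1.phi₀ l).toNat := by
  change stringLength ((crystalB01 l).f 0) b = _
  refine stringLength_eq (fun b : BSet l => (b.1.phi₀ l).toNat) (fun b hb => ?_)
    (fun b hb => ?_) b
  · rw [f_zero, toBSet_of_not_mem]
    rw [b.2.F₀_iff]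
    omega
  · have h : b.1.F₀.Mem l := b.2.F₀ (by omega)
    refine ⟨⟨_, h⟩, by rw [f_zero, toBSet_of_mem h], ?_⟩
    have := Coord.phi₀_F₀ l b.1
    dsimp only
    omega

theorem φ_one (b : BSet l) : (crystalB01 l).φ 1 b = b.1.phi₁.toNat := by
  change stringLength ((crystalB01 l).f 1) b = _
  refine stringLength_eq (fun b : BSet l => b.1.phi₁.toNat) (fun b hb => ?_)
    (fun b hb => ?_) b
  · rw [f_one, toBSet_of_not_mem]
    rw [b.2.F₁_iff]
    omega
  · have h : b.1.F₁.Mem l := b.2.F₁ (by omega)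
    refine ⟨⟨_, h⟩, by rw [f_one, toBSet_of_mem h], ?_⟩
    have := Coord.phi₁_F₁ b.1
    dsimp only
    omega

/-- The total maps are inverse bijections of ℤ⁶ and both ends are known to lie in `B_l`. -/
theorem e_eq_some_iff (i : Fin 2) (b b' : BSet l) :
    (crystalB01 l).e i b = some b' ↔ (crystalB01 l).f i b' = some b := by
  match i with
  | 0 =>
    rw [e_zero, f_zero]
    constructor <;> intro h
    · rw [← toBSet_eq_some h, Coord.F₀_E₀, toBSet_of_mem b.2]
    · rw [← toBSet_eq_some h, Coord.E₀_F₀, toBSet_of_mem b'.2]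
  | 1 =>
    rw [e_one, f_one]
    constructor <;> intro h
    · rw [← toBSet_eq_some h, Coord.F₁_E₁, toBSet_of_mem b.2]
    · rw [← toBSet_eq_some h, Coord.E₁_F₁, toBSet_of_mem b'.2]

theorem step_symm {b b' : BSet l} (h : (crystalB01 l).Step b b') : (crystalB01 l).Step b' b := by
  obtain ⟨i, h | h⟩ := h
  · exact ⟨i, Or.inr ((e_eq_some_iff i b b').1 h)⟩
  · exact ⟨i, Or.inl ((e_eq_some_iff i b' b).2 h)⟩

end crystalB01

/-! ### Tableaux and the components of `B_l` -/

namespace DecompIndex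

variable {l : ℕ} (D : DecompIndex l)

/-- The map from tableaux to `B_l` with `t(p, q, r) ↦ f₀^r f₁^q f₀^p b̄`. -/
def ofTab (t : TabA2 D.j₀ D.j₁) : BSet l :=
  ⟨stringVertex Coord.F₀ Coord.F₁ (bBarCoord l D.i D.j₀ D.j₁) t.p t.q t.r,
    (Coord.localA2 l).mem_tab (Coord.isHighest_bBar D) t⟩

theorem ofTab_top : D.ofTab (TabA2.top D.j₀ D.j₁) = bBar D := rfl

theorem f_zero_ofTab (t : TabA2 D.j₀ D.j₁) :
    (crystalB01 l).f 0 (D.ofTab t) = t.f₀.map D.ofTab := by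
  have hφ := (Coord.localA2 l).φ₀_tab (Coord.isHighest_bBar D) t
  rw [crystalB01.f_zero, TabA2.f₀]
  split_ifs with h
  · have e : (D.ofTab t).1.F₀ = stringVertex _ _ _ _ _ _ := F₀_stringVertex _ _ _ _
    rw [e]
    exact toBSet_of_mem (D.ofTab ⟨t.p, t.q, t.r + 1, _, _, _, _⟩).2
  · refine toBSet_of_not_mem ?_
    rw [(D.ofTab t).2.F₀_iff]
    change ¬ 0 < Coord.phi₀ l (stringVertex _ _ _ _ _ _)
    rw [hφ]
    omega

theorem f_one_ofTab (t : TabA2 D.j₀ D.j₁) :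
    (crystalB01 l).f 1 (D.ofTab t) = t.f₁.map D.ofTab := by
  have A := Coord.localA2 l
  have H := Coord.isHighest_bBar D
  have hφ := A.φ₁_tab H t
  have h1 := t.p_le
  have h2 := t.p_le_q
  have h3 := t.q_le
  have h4 := t.r_le
  rw [crystalB01.f_one, TabA2.f₁]
  split_ifs with h h'
  · refine Eq.trans (congrArg (toBSet l) ?_) (toBSet_of_mem (D.ofTab _).2)
    have := A.F₁_upper H (p := t.p) (q := t.q) (r := t.r - 1) h2 h3 (by omega) (by omega)
    rwa [Nat.sub_add_cancel (by omega)] at this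
  · refine Eq.trans (congrArg (toBSet l) ?_) (toBSet_of_mem (D.ofTab _).2)
    exact A.F₁_lower H h1 h3 (by omega)
  · refine toBSet_of_not_mem ?_
    rw [(D.ofTab t).2.F₁_iff]
    change ¬ 0 < Coord.phi₁ (stringVertex _ _ _ _ _ _)
    rw [hφ]
    omega

theorem f_ofTab (i : Fin 2) (t : TabA2 D.j₀ D.j₁) :
    (crystalB01 l).f i (D.ofTab t) = ((crystalA2 D.j₀ D.j₁).f i t).map D.ofTab := by
  match i with
  | 0 => exact D.f_zero_ofTab t
  | 1 => exact D.f_one_ofTab t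

theorem f_ofTab_eq_some {i : Fin 2} {t s : TabA2 D.j₀ D.j₁}
    (h : (crystalA2 D.j₀ D.j₁).f i t = some s) :
    (crystalB01 l).f i (D.ofTab t) = some (D.ofTab s) :=
  (D.f_ofTab i t).trans (congrArg (Option.map D.ofTab) h)

theorem exists_of_f_ofTab {i : Fin 2} {t : TabA2 D.j₀ D.j₁} {b : BSet l}
    (h : (crystalB01 l).f i (D.ofTab t) = some b) : ∃ s, D.ofTab s = b :=
  (Option.map_eq_some_iff.1 ((D.f_ofTab i t).symm.trans h)).imp fun _ h => h.2

theorem e_ofTab (i : Fin 2) (t : TabA2 D.j₀ D.j₁) :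
    (crystalB01 l).e i (D.ofTab t) = ((crystalA2 D.j₀ D.j₁).e i t).map D.ofTab := by
  have A := Coord.localA2 l
  have H := Coord.isHighest_bBar D
  -- Nonzero values of `e` are obtained by reversing `f`-arrows of tableaux; zero values come from
  -- the vanishing of ε.
  have of_f : ∀ s : TabA2 D.j₀ D.j₁, (crystalA2 D.j₀ D.j₁).f i s = some t →
      (crystalB01 l).e i (D.ofTab t) = some (D.ofTab s) := fun s hs =>
    (crystalB01.e_eq_some_iff i _ _).2 (D.f_ofTab_eq_some hs)
  have h1 := t.p_le
  have h2 := t.p_le_q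
  have h3 := t.q_le
  have h4 := t.r_le
  match i with
  | 0 =>
    change _ = t.e₀.map D.ofTab
    rw [TabA2.e₀]
    split_ifs with h
    · refine of_f _ ?_
      change TabA2.f₀ _ = _
      rw [TabA2.f₀, dif_pos (by dsimp only; omega)]
      congr 1
      ext <;> dsimp only
      omega
    · rw [crystalB01.e_zero, toBSet_of_not_mem]
      · rfl
      · rw [(D.ofTab t).2.E₀_iff]
        change ¬ 0 < Coord.eps₀ l (stringVertex _ _ _ _ _ _)
        rw [A.ε₀_tab H t]
        omega
  | 1 =>
    change _ = t.e₁.map D.ofTab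
    rw [TabA2.e₁]
    split_ifs with h h'
    · refine of_f _ ?_
      change TabA2.f₁ _ = _
      rw [TabA2.f₁, dif_pos (by dsimp only; omega)]
      congr 1
      ext <;> dsimp only <;> omega
    · rw [crystalB01.e_one, toBSet_of_not_mem]
      · rfl
      · rw [(D.ofTab t).2.E₁_iff]
        change ¬ 0 < Coord.eps₁ (stringVertex _ _ _ _ _ _)
        rw [A.ε₁_tab H t]
        omega
    · refine of_f _ ?_
      change TabA2.f₁ _ = _
      rw [TabA2.f₁, dif_neg (by dsimp only; omega), dif_pos (by dsimp only; omega)]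
      congr 1
      ext <;> dsimp only
      omega

theorem exists_of_e_ofTab {i : Fin 2} {t : TabA2 D.j₀ D.j₁} {b : BSet l}
    (h : (crystalB01 l).e i (D.ofTab t) = some b) : ∃ s, D.ofTab s = b :=
  (Option.map_eq_some_iff.1 ((D.e_ofTab i t).symm.trans h)).imp fun _ h => h.2

/-- Every tableau other than the top one admits `e₀` or `e₁`, and each lowers `p + q + r` by one. -/
theorem ofTab_mem_component (t : TabA2 D.j₀ D.j₁) :
    D.ofTab t ∈ (crystalB01 l).componentSet (bBar D) := by
  induction hn : t.p + t.q + t.r using Nat.strong_induction_on generalizing t with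
  | _ n ih =>
    have of_e : ∀ i (s : TabA2 D.j₀ D.j₁), (crystalA2 D.j₀ D.j₁).e i t = some s →
        s.p + s.q + s.r < n →
        D.ofTab t ∈ (crystalB01 l).componentSet (bBar D) := by
      intro i s hs hlt
      have h1 : (crystalB01 l).e i (D.ofTab t) = some (D.ofTab s) :=
        (D.e_ofTab i t).trans (congrArg (Option.map D.ofTab) hs)
      exact (ih _ hlt s rfl).trans _ _ _
        (Relation.EqvGen.rel _ _ (crystalB01.step_symm ⟨i, Or.inl h1⟩))
    have h1 := t.p_le
    have h2 := t.p_le_q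
    by_cases hr : 0 < t.r
    · exact of_e 0 _ (if_pos hr) (by dsimp only; omega)
    by_cases hq : t.q ≤ t.p + t.r
    · by_cases hp : 0 < t.p
      · refine of_e 1 _ ((dif_pos hq).trans (dif_pos hp)) (by dsimp only; omega)
      · have : t = TabA2.top D.j₀ D.j₁ := by
          ext <;> simp only [TabA2.top] <;> omega
        rw [this, ofTab_top]
        exact Relation.EqvGen.refl _
    · exact of_e 1 _ (dif_neg hq) (by dsimp only; omega)

/-- The image of `ofTab` contains `b̄` and is closed under arrows in both directions. -/
theorem mem_component_iff (b : BSet l) :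
    b ∈ (crystalB01 l).componentSet (bBar D) ↔ ∃ t, D.ofTab t = b := by
  constructor
  · intro h
    have fwd : ∀ b b', (crystalB01 l).Step b b' → (∃ t, D.ofTab t = b) → ∃ t, D.ofTab t = b' := by
      rintro b b' ⟨i, h | h⟩ ⟨t, rfl⟩
      · exact D.exists_of_e_ofTab h
      · exact D.exists_of_f_ofTab h
    have key : ∀ b b', (crystalB01 l).Linked b b' →
        ((∃ t, D.ofTab t = b) ↔ ∃ t, D.ofTab t = b') := by
      intro b b' hb
      induction hb with
      | rel b b' h => exact ⟨fwd _ _ h, fwd _ _ (crystalB01.step_symm h)⟩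
      | refl => exact Iff.rfl
      | symm _ _ _ ih => exact ih.symm
      | trans _ _ _ _ _ ih ih' => exact ih.trans ih'
    exact (key _ _ h).1 ⟨_, D.ofTab_top⟩
  · rintro ⟨t, rfl⟩
    exact D.ofTab_mem_component t

end DecompIndex

theorem ofTab_unique {l : ℕ} {D D' : DecompIndex l} {t : TabA2 D.j₀ D.j₁}
    {t' : TabA2 D'.j₀ D'.j₁} (h : D.ofTab t = D'.ofTab t') :
    D = D' ∧ t.p = t'.p ∧ t.q = t'.q ∧ t.r = t'.r := by
  obtain ⟨h₁, h₂⟩ := (Coord.localA2 l).tab_unique (Coord.isHighest_bBar D) t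
    (Coord.isHighest_bBar D') t' (congrArg Subtype.val h)
  exact ⟨Coord.bBarCoord_injective h₂, h₁⟩

/-- The bound only serves termination; the constant 20 is not sharp. -/
theorem Coord.Mem.wt_le {l : ℕ} {b : Coord} (h : b.Mem l) :
    (b.phi₀ l - b.eps₀ l) + (b.phi₁ - b.eps₁) ≤ 20 * l := by
  obtain ⟨⟨h₁, h₂, h₃, h₄, h₅, h₆⟩, -, hs⟩ := h
  simp only [Coord.s] at hs
  simp only [Coord.eps₀, Coord.phi₁, Coord.eps₁, Coord.z₁, Coord.z₂, Coord.z₃, Coord.z₄]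
  omega

/-- Each `e` raises `wt₀ + wt₁` by `2 - 1 = 1`, so climbing stops, necessarily at a vertex with ε₀ =
ε₁ = 0, which is some `b̄`. -/
theorem exists_ofTab_eq {l : ℕ} (b : BSet l) :
    ∃ (D : DecompIndex l) (t : TabA2 D.j₀ D.j₁), D.ofTab t = b := by
  induction hn : (20 * (l : ℤ) - ((b.1.phi₀ l - b.1.eps₀ l) + (b.1.phi₁ - b.1.eps₁))).toNat
    using Nat.strong_induction_on generalizing b with
  | _ n ih =>
    have of_e : ∀ i (b' : BSet l), (crystalB01 l).e i b = some b' →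
        (∃ (D : DecompIndex l) (t : TabA2 D.j₀ D.j₁), D.ofTab t = b') →
        ∃ (D : DecompIndex l) (t : TabA2 D.j₀ D.j₁), D.ofTab t = b := by
      rintro i b' hb ⟨D, t, rfl⟩
      exact ⟨D, D.exists_of_f_ofTab ((crystalB01.e_eq_some_iff i b _).1 hb)⟩
    by_cases h₀ : 0 < b.1.eps₀ l
    · have hm := b.2.E₀ h₀
      have h1 := Coord.wt₀_F₀ l b.1.E₀
      have h2 := Coord.wt₁_F₀ b.1.E₀
      rw [Coord.F₀_E₀] at h1 h2
      have hw := hm.wt_le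
      have hlt : (20 * (l : ℤ) - ((b.1.E₀.phi₀ l - b.1.E₀.eps₀ l) +
          (b.1.E₀.phi₁ - b.1.E₀.eps₁))).toNat < n := by
        omega
      exact of_e 0 ⟨_, hm⟩ ((crystalB01.e_zero b).trans (toBSet_of_mem hm)) (ih _ hlt ⟨_, hm⟩ rfl)
    by_cases h₁ : 0 < b.1.eps₁
    · have hm := b.2.E₁ h₁
      have h1 := Coord.wt₀_F₁ l b.1.E₁
      have h2 := Coord.wt₁_F₁ b.1.E₁
      rw [Coord.F₁_E₁] at h1 h2
      have hw := hm.wt_le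
      have hlt : (20 * (l : ℤ) - ((b.1.E₁.phi₀ l - b.1.E₁.eps₀ l) +
          (b.1.E₁.phi₁ - b.1.E₁.eps₁))).toNat < n := by omega
      exact of_e 1 ⟨_, hm⟩ ((crystalB01.e_one b).trans (toBSet_of_mem hm)) (ih _ hlt ⟨_, hm⟩ rfl)
    obtain ⟨D, hD⟩ := b.2.exists_eq_bBar (le_antisymm (not_lt.1 h₀) b.2.eps₀_nonneg)
      (le_antisymm (not_lt.1 h₁) b.2.eps₁_nonneg)
    exact ⟨D, TabA2.top D.j₀ D.j₁, D.ofTab_top.trans (Subtype.ext hD.symm)⟩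

/-- This lets identities between operators of a component be checked in the ambient crystal. -/
theorem Option.map_val_pmap {α : Type} {P : α → Prop} (o : Option α) (h : ∀ a, o = some a → P a) :
    (o.pmap (fun a ha => (⟨a, ha⟩ : {a // P a})) h).map Subtype.val = o := by
  cases o <;> rfl

namespace DecompIndex

variable {l : ℕ} (D : DecompIndex l)

theorem ε_ofTab (i : Fin 2) (t : TabA2 D.j₀ D.j₁) :
    (crystalB01 l).ε i (D.ofTab t) = (crystalA2 D.j₀ D.j₁).ε i t := by
  have A := Coord.localA2 l
  have H := Coord.isHighest_bBar D
  match i with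
  | 0 =>
    refine Eq.trans (crystalB01.ε_zero (D.ofTab t)) ?_
    exact (congrArg Int.toNat (A.ε₀_tab H t)).trans (Int.toNat_natCast _)
  | 1 =>
    refine Eq.trans (crystalB01.ε_one (D.ofTab t)) ?_
    exact (congrArg Int.toNat (A.ε₁_tab H t)).trans (Int.toNat_natCast _)

theorem φ_ofTab (i : Fin 2) (t : TabA2 D.j₀ D.j₁) :
    (crystalB01 l).φ i (D.ofTab t) = (crystalA2 D.j₀ D.j₁).φ i t := by
  have A := Coord.localA2 l
  have H := Coord.isHighest_bBar D
  match i with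
  | 0 =>
    refine Eq.trans (crystalB01.φ_zero (D.ofTab t)) ?_
    exact (congrArg Int.toNat (A.φ₀_tab H t)).trans (Int.toNat_natCast _)
  | 1 =>
    refine Eq.trans (crystalB01.φ_one (D.ofTab t)) ?_
    exact (congrArg Int.toNat (A.φ₁_tab H t)).trans (Int.toNat_natCast _)

/-- The bijection between tableaux and the component of `b̄`. -/
noncomputable def tabEquiv :
    TabA2 D.j₀ D.j₁ ≃ {b : BSet l // b ∈ (crystalB01 l).componentSet (bBar D)} :=
  Equiv.ofBijective (fun t => ⟨D.ofTab t, D.ofTab_mem_component t⟩)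
    ⟨fun t t' h => by
      obtain ⟨-, hp, hq, hr⟩ := ofTab_unique (congrArg Subtype.val h)
      exact TabA2.ext hp hq hr,
    fun b => by
      obtain ⟨t, ht⟩ := (D.mem_component_iff b.1).1 b.2
      exact ⟨t, Subtype.ext ht⟩⟩

/-- The isomorphism from the crystal of tableaux to the component of `b̄`. -/
noncomputable def tabIso :
    CrystalData.Iso (crystalA2 D.j₀ D.j₁) ((crystalB01 l).component (bBar D)) where
  toEquiv := D.tabEquiv
  map_e i t := by
    apply Option.map_injective Subtype.val_injective
    refine (Option.map_val_pmap _ _).trans ((D.e_ofTab i t).trans ?_)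
    exact (Option.map_map Subtype.val D.tabEquiv _).symm
  map_f i t := by
    apply Option.map_injective Subtype.val_injective
    refine (Option.map_val_pmap _ _).trans ((D.f_ofTab i t).trans ?_)
    exact (Option.map_map Subtype.val D.tabEquiv _).symm
  map_ε i t := D.ε_ofTab i t
  map_φ i t := D.φ_ofTab i t

end DecompIndex

/-- For `l ≥ 1`, after forgetting `2`-arrows, `B_l` is the disjoint union of the connected
components of the elements `b̄`, and each component is isomorphic, as a crystal with colours
`0, 1`, to `B^{A₂}(j₀Λ₀ + j₁Λ₁)`, where `b̄` corresponds to the highest weight element. -/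
theorem mainTheorem3 (l : ℕ) (hl : 0 < l) :
    (⋃ d : DecompIndex l, (crystalB01 l).componentSet (bBar d)) = Set.univ ∧
    (∀ d d' : DecompIndex l, d ≠ d' →
      Disjoint ((crystalB01 l).componentSet (bBar d)) ((crystalB01 l).componentSet (bBar d'))) ∧
    (∀ d : DecompIndex l,
      ∃ ψ : CrystalData.Iso (crystalA2 d.j₀ d.j₁) ((crystalB01 l).component (bBar d)),
        ψ.toEquiv (TabA2.top d.j₀ d.j₁) = (crystalB01 l).componentBase (bBar d)) := by
  refine ⟨Set.eq_univ_of_forall fun b => ?_, fun d d' hd => ?_, fun d => ⟨d.tabIso, rfl⟩⟩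
  · obtain ⟨D, t, rfl⟩ := exists_ofTab_eq b
    exact Set.mem_iUnion.2 ⟨D, D.ofTab_mem_component t⟩
  · rw [Set.disjoint_left]
    intro b hb hb'
    obtain ⟨t, rfl⟩ := (d.mem_component_iff b).1 hb
    obtain ⟨t', ht'⟩ := (d'.mem_component_iff _).1 hb'
    exact hd (ofTab_unique ht').1.symm
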